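/- Let $n\ge 2$ be an integer, let $B_R\subset\mathbf R^n$ be the open ball of radius $R$ centred at $0$, and let $\alpha,s\in\mathbf R$ satisfy $$0<2\alpha<n,\qquad 0<2s<n,\qquad 2\alpha-\frac n2<s<2\alpha .$$ For $t\in\mathbf R$ let $H^t(\mathbf R^n)$ be the $L^2$-based Sobolev space of complex-valued tempered distributions, and let $H^t(B_R)$ be the set of distributions on $B_R$ that are restrictions to $B_R$ of elements of $H^t(\mathbf R^n)$. Let $\Delta^\alpha\colon H^t(\mathbf R^n)\to H^{t-2\alpha}(\mathbf R^n)$ be the Fourier multiplier with symbol $|\xi|^{2\alpha}$ (so that $\Delta^1=-\sum_j\partial_j^2$). Then there is $\varepsilon=\varepsilon(n,\alpha,s)>0$ such that the following holds for every complex-valued $V\in L^{n/(2\alpha)}(B_1)$ and every $u\in H^s(B_1)$. The pointwise product $Vu$ is locally integrable on $B_1$, hence a distribution on $B_1$. If $u$ solves $$\Delta^\alpha u+Vu=0\quad\text{in }B_1,$$ that is, if $u$ has an extension $\tilde u\in H^s(\mathbf R^n)$ with $\Delta^\alpha\tilde u+Vu=0$ as distributions on $B_1$, then $u|_{B_{1/2}}\in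 H^{s+\varepsilon}(B_{1/2})$. -/

import Mathlib

open MeasureTheory TopologicalSpace
open scoped SchwartzMap Distributions FourierTransform ContDiff

/-- The open ball of radius `r` centred at the origin of `ℝⁿ`, as an open set. -/
def openBall (n : ℕ) (r : ℝ) : Opens (EuclideanSpace ℝ (Fin n)) :=
  ⟨Metric.ball 0 r, Metric.isOpen_ball⟩

/-- A real test function on `Ω`, viewed as a (complex valued) Schwartz function on `ℝⁿ`. -/
noncomputable def testToSchwartz {n : ℕ} {Ω : Opens (EuclideanSpace ℝ (Fin n))}
    (φ : 𝓓(Ω, ℝ)) : 𝓢(EuclideanSpace ℝ (Fin n), ℂ) :=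
  HasCompactSupport.toSchwartzMap (f := fun x => (φ x : ℂ))
    (φ.hasCompactSupport.comp_left (g := fun t : ℝ => (t : ℂ)) Complex.ofReal_zero)
    (Complex.ofRealCLM.contDiff.comp φ.contDiff)

/-- `w|_Ω = u`: the tempered distribution `w` on `ℝⁿ` extends the distribution `u` on `Ω`. -/
def IsExtension {n : ℕ} {Ω : Opens (EuclideanSpace ℝ (Fin n))}
    (w : 𝓢'(EuclideanSpace ℝ (Fin n), ℂ)) (u : 𝓓'(Ω, ℂ)) : Prop :=
  ∀ φ : 𝓓(Ω, ℝ), u φ = w (testToSchwartz φ)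

/-- `u ∈ H^s(Ω)`: the distribution `u` on `Ω` is the restriction to `Ω` of some element
of `H^s(ℝⁿ)`. -/
def MemSobolevOn {n : ℕ} {Ω : Opens (EuclideanSpace ℝ (Fin n))}
    (s : ℝ) (u : 𝓓'(Ω, ℂ)) : Prop :=
  ∃ w : 𝓢'(EuclideanSpace ℝ (Fin n), ℂ),
    TemperedDistribution.MemSobolev s 2 w ∧ IsExtension w u

/-- The restriction `u|_Ω'` of a distribution `u` on `Ω` to an open subset `Ω' ⊆ Ω`. -/
noncomputable def restrictTo {n : ℕ} {Ω Ω' : Opens (EuclideanSpace ℝ (Fin n))}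
    (_h : Ω' ≤ Ω) (u : 𝓓'(Ω, ℂ)) : 𝓓'(Ω', ℂ) :=
  (TestFunction.monoCLM ℝ : 𝓓(Ω', ℝ) →L[ℝ] 𝓓(Ω, ℝ)).precompCompactConvergenceCLM ℂ u

/-- The tempered distribution `T` is given by the measurable function `g`. -/
def IsGivenBy {n : ℕ} (T : 𝓢'(EuclideanSpace ℝ (Fin n), ℂ))
    (g : EuclideanSpace ℝ (Fin n) → ℂ) : Prop :=
  ∀ φ : 𝓢(EuclideanSpace ℝ (Fin n), ℂ),
    Integrable (fun x => φ x * g x) ∧ T φ = ∫ x, φ x * g x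

/-- `v = Δ^α u`, where `Δ^α` is the pseudodifferential operator with symbol `|ξ|^{2α}`,
that is, the Fourier multiplier with `(2π‖ξ‖)^{2α}` for the Fourier transform
`∫ e^{-2πi⟨x, ξ⟩} u(x) dx`. It is a relation between tempered distributions: the Fourier
transform of `u` is a function `g`, as for every `u` in some `H^s(ℝⁿ)`, and the Fourier
transform of `v` is the function `(2π‖ξ‖)^{2α} g`. -/
def IsFracLaplacian {n : ℕ} (α : ℝ) (u v : 𝓢'(EuclideanSpace ℝ (Fin n), ℂ)) : Prop :=
  ∃ g : EuclideanSpace ℝ (Fin n) → ℂ,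
    IsGivenBy (𝓕 u) g ∧
    IsGivenBy (𝓕 v) (fun ξ => (((2 * Real.pi * ‖ξ‖) ^ (2 * α) : ℝ) : ℂ) * g ξ)

/-- The distribution `u` on `Ω` is given by the locally integrable function `f`. -/
def IsGivenByOn {n : ℕ} {Ω : Opens (EuclideanSpace ℝ (Fin n))} (u : 𝓓'(Ω, ℂ))
    (f : EuclideanSpace ℝ (Fin n) → ℂ) : Prop :=
  LocallyIntegrableOn f Ω ∧ ∀ φ : 𝓓(Ω, ℝ), u φ = ∫ x, (φ x : ℂ) * f x

/-- `w = V u` as distributions on `Ω`: both `u` and its pointwise product with `V` are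
locally integrable functions on `Ω`, and `w` is the distribution given by that product. -/
def IsProduct {n : ℕ} {Ω : Opens (EuclideanSpace ℝ (Fin n))}
    (V : EuclideanSpace ℝ (Fin n) → ℂ) (u w : 𝓓'(Ω, ℂ)) : Prop :=
  ∃ f : EuclideanSpace ℝ (Fin n) → ℂ,
    IsGivenByOn u f ∧ IsGivenByOn w (fun x => V x * f x)

/-- `u ∈ H^s(Ω)` solves `Δ^α u + V u = 0` in `Ω`: some extension `u'` of `u` in `H^s(ℝⁿ)`
satisfies `Δ^α u' + V u = 0` when tested against every test function on `Ω`. -/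
def IsSolution {n : ℕ} {Ω : Opens (EuclideanSpace ℝ (Fin n))} (α s : ℝ)
    (V : EuclideanSpace ℝ (Fin n) → ℂ) (u : 𝓓'(Ω, ℂ)) : Prop :=
  ∃ (u' v : 𝓢'(EuclideanSpace ℝ (Fin n), ℂ)) (w : 𝓓'(Ω, ℂ)),
    TemperedDistribution.MemSobolev s 2 u' ∧ IsExtension u' u ∧
    IsFracLaplacian α u' v ∧ IsProduct V u w ∧
    ∀ φ : 𝓓(Ω, ℝ), v (testToSchwartz φ) + w φ = 0

/-! Write `c = 2α`, `⟨ξ⟩ = (1 + ‖ξ‖²)^{1/2}`, and let `ψ` be a cutoff supported in the unit ball and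
equal to `1` on the half ball. Up to a constant absorbed in the potential `U`, the localized
solution satisfies `⟨D⟩^c (ψu) + U ψu = ⟨D⟩^c (ψu) - ψ |D|^c u`. The right side lies in `H^{s-c+ε}`
for `ε ≤ 1`: in frequency its kernel is `(⟨ξ⟩^c - |η|^c)` times a Schwartz function of `η - ξ`, and
the difference of symbols gains one order (`abs_jap_sub_norm_rpow_le`, then Schur's test in
`exists_commutator_eq`).

The potential is critical, so `Uψu` is of the same order as the main term and cannot be bootstrapped
directly. Split `U = W + V` with `W` small in `L^{n/c}` and `V` bounded. Then `Vψu` is in `L²`,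
inside `H^{s-c+ε}` because `s + ε < c`. For `W`, the critical Sobolev embeddings of `H^t` and
`H^{c-t}` with Hölder's inequality bound `⟨D⟩^{t-c} W ⟨D⟩^{-t}` on `L²` by a multiple of the norm of
`W` (`exists_potential_operator`), both for `t = s` and for `t = s + ε`.

With `A` the Fourier transform of `⟨D⟩^s (ψu)` and `J` multiplication by `⟨ξ⟩^{-ε}`, the equation
reads `(1 + P)† A = J B` with `B` in `L²`. The operators `P`, `P'` at levels `s`, `s + ε` satisfy `J
P = P' J` and are both small. Inverting at both levels gives `A = J G` (`exists_eq_of_intertwine`),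
that is, `ψu ∈ H^{s+ε}`. -/

open scoped ENNReal ComplexConjugate
set_option linter.unusedSectionVars false

/-! ### Real interpolation between bounded and square integrable parts -/

section WeakType

variable {E : Type*} [NormedAddCommGroup E] [MeasurableSpace E] [BorelSpace E]

lemma lintegral_Ioo_rpow {a : ℝ} (ha : 0 < a) {b : ℝ} (hb : 0 ≤ b) :
    ∫⁻ l in Set.Ioo 0 b, ENNReal.ofReal (l ^ (a - 1)) = ENNReal.ofReal (b ^ a / a) := by
  rw [← ofReal_integral_eq_lintegral_ofReal]
  · rw [← integral_Ioc_eq_integral_Ioo, ← intervalIntegral.integral_of_le hb,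
      integral_rpow (Or.inl (by linarith))]
    simp [Real.zero_rpow ha.ne']
  · have := (intervalIntegrable_iff_integrableOn_Ioc_of_le hb).mp
      (intervalIntegral.intervalIntegrable_rpow' (r := a - 1) (by linarith))
    exact this.mono_set Set.Ioo_subset_Ioc_self
  · filter_upwards [ae_restrict_mem measurableSet_Ioo] with x hx
    exact Real.rpow_nonneg hx.1.le _

/-- Chebyshev's inequality for the remainder of a function after removal of a bounded part. -/
lemma meas_lt_norm_le_of_split {α : Type*} [MeasurableSpace α] {μ : Measure α} {F F₁ F₂ : α → ℂ}
    {l : ℝ} (hl : 0 < l) (hF : F =ᵐ[μ] F₁ + F₂) (h₁ : ∀ᵐ x ∂μ, ‖F₁ x‖ ≤ l / 2)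
    (h₂ : AEStronglyMeasurable F₂ μ) :
    μ {x | l < ‖F x‖} ≤ ENNReal.ofReal (4 * l ^ (-2 : ℝ)) * ∫⁻ x, ‖F₂ x‖ₑ ^ (2 : ℝ) ∂μ := by
  have hl2 : 0 < (l / 2) ^ (2 : ℝ) := by positivity
  calc μ {x | l < ‖F x‖}
      ≤ μ {x | ENNReal.ofReal ((l / 2) ^ (2 : ℝ)) ≤ ‖F₂ x‖ₑ ^ (2 : ℝ)} := by
        apply measure_mono_ae
        filter_upwards [hF, h₁] with x hx hx1 (hlx : l < ‖F x‖)
        change ENNReal.ofReal ((l / 2) ^ (2 : ℝ)) ≤ ‖F₂ x‖ₑ ^ (2 : ℝ)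
        rw [← ENNReal.ofReal_rpow_of_pos (by positivity), ← ofReal_norm]
        gcongr
        rw [hx, Pi.add_apply] at hlx
        linarith [norm_add_le (F₁ x) (F₂ x)]
    _ ≤ (∫⁻ x, ‖F₂ x‖ₑ ^ (2 : ℝ) ∂μ) / ENNReal.ofReal ((l / 2) ^ (2 : ℝ)) :=
        meas_ge_le_lintegral_div (h₂.enorm.pow_const _) (by simpa using hl.ne') (by simp)
    _ = _ := by
        rw [ENNReal.div_eq_inv_mul, ← ENNReal.ofReal_inv_of_pos hl2]
        congr 2
        rw [Real.div_rpow hl.le (by norm_num), Real.rpow_neg hl.le]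
        have : (2 : ℝ) ^ (2 : ℝ) = 4 := by norm_num
        rw [this]; field_simp

/-- Real interpolation of the family of splittings of `F` into a part bounded by `K * A ^ r` and a
part with square integral at most `∫_{‖ξ‖ > A} ‖ξ‖ ^ (-a) |G|²`. -/
lemma lintegral_rpow_le_of_split {μ : Measure E} [SFinite μ]
    {F G : E → ℂ} {K r p a : ℝ} (hK : 0 < K) (hr : 0 < r)
    (hp : 2 < p) (hrp : r * (p - 2) = a) (hF : AEStronglyMeasurable F μ)
    (hG : AEStronglyMeasurable G μ) (h0 : μ {0} = 0)
    (h : ∀ A : ℝ, 0 < A → ∃ F₁ F₂ : E → ℂ, F =ᵐ[μ] F₁ + F₂ ∧ (∀ᵐ x ∂μ, ‖F₁ x‖ ≤ K * A ^ r) ∧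
      AEStronglyMeasurable F₂ μ ∧ ∫⁻ x, ‖F₂ x‖ₑ ^ (2 : ℝ) ∂μ ≤
        ∫⁻ ξ, {ξ : E | A < ‖ξ‖}.indicator
          (fun ξ => ENNReal.ofReal (‖ξ‖ ^ (-a)) * ‖G ξ‖ₑ ^ (2 : ℝ)) ξ ∂μ) :
    ∫⁻ x, ENNReal.ofReal (‖F x‖ ^ p) ∂μ ≤
      ENNReal.ofReal (p * (4 * ((2 * K) ^ (p - 2) / (p - 2)))) * ∫⁻ ξ, ‖G ξ‖ₑ ^ (2 : ℝ) ∂μ := by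
  have hp0 : 0 < p := by linarith
  rw [lintegral_rpow_eq_lintegral_meas_lt_mul μ (.of_forall fun x => norm_nonneg _)
    hF.norm.aemeasurable hp0, ENNReal.ofReal_mul hp0.le, mul_assoc]
  gcongr
  set w : E → ℝ≥0∞ := fun ξ => ENNReal.ofReal (‖ξ‖ ^ (-a)) * ‖G ξ‖ₑ ^ (2 : ℝ) with hw
  have hwm : AEMeasurable w μ := by
    apply AEMeasurable.mul (by fun_prop) (hG.enorm.pow_const _)
  have hlam : ∀ l ∈ Set.Ioi (0 : ℝ),
      μ {x | l < ‖F x‖} * ENNReal.ofReal (l ^ (p - 1)) ≤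
        ∫⁻ ξ, w ξ * (Set.Ioo 0 (2 * K * ‖ξ‖ ^ r)).indicator
          (fun l => ENNReal.ofReal (4 * l ^ (p - 2 - 1))) l ∂μ := by
    intro l (hl : 0 < l)
    -- The threshold solves `K * A ^ r = l / 2`, so the bounded part alone never reaches the level
    -- `l`.
    have hA : 0 < (l / (2 * K)) ^ r⁻¹ := by positivity
    obtain ⟨F₁, F₂, hF12, hF₁, hF₂m, hF₂⟩ := h _ hA
    have e1 : K * ((l / (2 * K)) ^ r⁻¹) ^ r = l / 2 := by
      rw [← Real.rpow_mul (by positivity), inv_mul_cancel₀ hr.ne', Real.rpow_one]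
      field_simp
    rw [e1] at hF₁
    calc μ {x | l < ‖F x‖} * ENNReal.ofReal (l ^ (p - 1))
        ≤ (ENNReal.ofReal (4 * l ^ (-2 : ℝ)) *
            ∫⁻ ξ, {ξ : E | (l / (2 * K)) ^ r⁻¹ < ‖ξ‖}.indicator w ξ ∂μ) *
              ENNReal.ofReal (l ^ (p - 1)) := by
          gcongr
          exact (meas_lt_norm_le_of_split hl hF12 hF₁ hF₂m).trans (by gcongr)
      _ = (ENNReal.ofReal (4 * l ^ (-2 : ℝ)) * ENNReal.ofReal (l ^ (p - 1))) *
            ∫⁻ ξ, {ξ : E | (l / (2 * K)) ^ r⁻¹ < ‖ξ‖}.indicator w ξ ∂μ := by ring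
      _ = ∫⁻ ξ, (ENNReal.ofReal (4 * l ^ (-2 : ℝ)) * ENNReal.ofReal (l ^ (p - 1))) *
            {ξ : E | (l / (2 * K)) ^ r⁻¹ < ‖ξ‖}.indicator w ξ ∂μ := by
          rw [lintegral_const_mul'' _ (hwm.indicator (measurableSet_lt (by fun_prop) (by fun_prop)))]
      _ ≤ _ := by
          -- The condition that `ξ` lies above the threshold of `l` is the condition `l < 2 * K *
          -- ‖ξ‖ ^ r`; for fixed `ξ` the levels form an interval, ready for Tonelli.
          apply lintegral_mono
          intro ξ
          simp only [Set.indicator_apply]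
          split_ifs with h1 h2
          · rw [mul_comm (w ξ), ← ENNReal.ofReal_mul (by positivity), mul_assoc,
              ← Real.rpow_add hl]
            apply le_of_eq; congr 4; ring
          · exfalso
            apply h2
            refine ⟨hl, ?_⟩
            have h1' : (l / (2 * K)) ^ r⁻¹ < ‖ξ‖ := h1
            have := Real.rpow_lt_rpow hA.le h1' hr
            rw [← Real.rpow_mul (by positivity), inv_mul_cancel₀ hr.ne', Real.rpow_one,
              div_lt_iff₀ (by positivity)] at this
            linarith
          · simp
          · simp
  calc ∫⁻ l in Set.Ioi 0, μ {x | l < ‖F x‖} * ENNReal.ofReal (l ^ (p - 1))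
      ≤ ∫⁻ l in Set.Ioi 0, ∫⁻ ξ, w ξ * (Set.Ioo 0 (2 * K * ‖ξ‖ ^ r)).indicator
          (fun l => ENNReal.ofReal (4 * l ^ (p - 2 - 1))) l ∂μ := by
        apply lintegral_mono_ae
        filter_upwards [ae_restrict_mem measurableSet_Ioi] with l hl using hlam l hl
    _ = ∫⁻ ξ, (∫⁻ l in Set.Ioi 0, w ξ * (Set.Ioo 0 (2 * K * ‖ξ‖ ^ r)).indicator
          (fun l => ENNReal.ofReal (4 * l ^ (p - 2 - 1))) l) ∂μ := by
        rw [lintegral_lintegral_swap]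
        apply AEMeasurable.mul
        · exact hwm.comp_snd
        · have : (fun q : ℝ × E => (Set.Ioo 0 (2 * K * ‖q.2‖ ^ r)).indicator
            (fun l => ENNReal.ofReal (4 * l ^ (p - 2 - 1))) q.1) =
            {q : ℝ × E | 0 < q.1 ∧ q.1 < 2 * K * ‖q.2‖ ^ r}.indicator
              (fun q => ENNReal.ofReal (4 * q.1 ^ (p - 2 - 1))) := by
            ext q; simp [Set.indicator_apply]
          apply Measurable.aemeasurable
          change Measurable (fun q : ℝ × E => (Set.Ioo 0 (2 * K * ‖q.2‖ ^ r)).indicator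
            (fun l => ENNReal.ofReal (4 * l ^ (p - 2 - 1))) q.1)
          rw [this]
          apply Measurable.indicator (by fun_prop)
          have m1 : MeasurableSet {q : ℝ × E | 0 < q.1} :=
            measurableSet_lt measurable_const measurable_fst
          have m2 : MeasurableSet {q : ℝ × E | q.1 < 2 * K * ‖q.2‖ ^ r} :=
            measurableSet_lt measurable_fst (by fun_prop)
          exact m1.inter m2
    _ = ∫⁻ ξ, ENNReal.ofReal (4 * ((2 * K) ^ (p - 2) / (p - 2))) * ‖G ξ‖ₑ ^ (2 : ℝ) ∂μ := by
        apply lintegral_congr_ae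
        have : ∀ᵐ ξ ∂μ, ξ ≠ 0 := by rw [ae_iff]; simpa using h0
        filter_upwards [this] with ξ hξ
        have hξ' : 0 < ‖ξ‖ := norm_pos_iff.mpr hξ
        rw [lintegral_const_mul _ (Measurable.indicator (by fun_prop) measurableSet_Ioo),
          lintegral_indicator measurableSet_Ioo, Measure.restrict_restrict measurableSet_Ioo,
          Set.inter_eq_left.mpr Set.Ioo_subset_Ioi_self]
        simp_rw [ENNReal.ofReal_mul (show (0 : ℝ) ≤ 4 by norm_num)]
        rw [lintegral_const_mul _ (by fun_prop),
          lintegral_Ioo_rpow (by linarith) (by positivity), hw]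
        simp only
        rw [mul_right_comm, ← ENNReal.ofReal_mul (by norm_num), ← ENNReal.ofReal_mul (by positivity),
          ← ENNReal.ofReal_mul (by norm_num)]
        congr 2
        -- By `r * (p - 2) = a`, integrating over levels produces `‖ξ‖ ^ a`, which cancels the
        -- weight exactly.
        rw [Real.mul_rpow (by positivity) (by positivity), ← Real.rpow_mul hξ'.le, hrp,
          Real.rpow_neg hξ'.le]
        have : ‖ξ‖ ^ a ≠ 0 := by positivity
        field_simp
    _ = _ := by
        rw [lintegral_const_mul'' _ (hG.enorm.pow_const _)]

end WeakType

/-! ### Japanese bracket weights -/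

section Weight

variable {E : Type*} [NormedAddCommGroup E]

/-- The weight `(1 + ‖ξ‖ ^ 2) ^ (t / 2)`. -/
noncomputable def jap (t : ℝ) (ξ : E) : ℝ := (1 + ‖ξ‖ ^ 2) ^ (t / 2)

lemma jap_pos (t : ℝ) (ξ : E) : 0 < jap t ξ := by unfold jap; positivity

lemma jap_mul (s t : ℝ) (ξ : E) : jap s ξ * jap t ξ = jap (s + t) ξ := by
  unfold jap
  rw [← Real.rpow_add (by positivity)]; ring_nf

@[simp] lemma jap_zero (ξ : E) : jap 0 ξ = 1 := by simp [jap]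

lemma jap_neg (t : ℝ) (ξ : E) : jap (-t) ξ = (jap t ξ)⁻¹ := by
  unfold jap
  rw [← Real.rpow_neg (by positivity)]; ring_nf

lemma jap_le_one {t : ℝ} (ht : t ≤ 0) (ξ : E) : jap t ξ ≤ 1 :=
  Real.rpow_le_one_of_one_le_of_nonpos (by simp) (by linarith)

lemma jap_neg_le {t : ℝ} (ht : 0 ≤ t) {ξ : E} (hξ : ξ ≠ 0) : jap (-t) ξ ≤ ‖ξ‖ ^ (-t) := by
  have h : 0 < ‖ξ‖ := norm_pos_iff.mpr hξ
  calc jap (-t) ξ ≤ (‖ξ‖ ^ (2 : ℝ)) ^ (-t / 2) :=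
        Real.rpow_le_rpow_of_nonpos (by positivity) (by simp) (by linarith)
    _ = _ := by rw [← Real.rpow_mul h.le]; ring_nf

lemma continuous_jap (t : ℝ) : Continuous (jap t : E → ℝ) := by
  unfold jap
  exact Continuous.rpow_const (by fun_prop) (fun x => Or.inl (by positivity))

end Weight

lemma hasTemperateGrowth_jap {E : Type*} [NormedAddCommGroup E] [InnerProductSpace ℝ E] (t : ℝ) :
    (fun ξ : E => (jap t ξ : ℂ)).HasTemperateGrowth := by
  unfold jap; fun_prop

/-! ### Bessel potentials and the critical Sobolev embedding -/

section Bessel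

variable {E : Type*} [NormedAddCommGroup E] [InnerProductSpace ℝ E] [FiniteDimensional ℝ E]
  [MeasurableSpace E] [BorelSpace E]

/-- The absolute value keeps the multiplier bounded for every real `t`, so `besselMul` needs no sign
hypothesis; only `t ≥ 0` is of interest. -/
lemma memLp_jap_neg_abs (t : ℝ) : MemLp (fun ξ : E => (jap (-|t|) ξ : ℂ)) ∞ volume := by
  apply memLp_top_of_bound (C := 1)
  · exact (Complex.continuous_ofReal.comp (continuous_jap _)).aestronglyMeasurable
  · refine .of_forall fun ξ => ?_
    rw [Complex.norm_real, Real.norm_of_nonneg (jap_pos _ _).le]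
    exact jap_le_one (by simp) ξ

/-- Multiplication by `(1 + ‖ξ‖ ^ 2) ^ (-|t| / 2)` on `L²`. -/
noncomputable def besselMul (t : ℝ) : Lp ℂ 2 (volume : Measure E) →L[ℂ] Lp ℂ 2 (volume : Measure E) :=
  (ContinuousLinearMap.mul ℂ ℂ).holderL volume ∞ 2 2 (memLp_jap_neg_abs t).toLp

lemma coeFn_besselMul {t : ℝ} (ht : 0 ≤ t) (G : Lp ℂ 2 (volume : Measure E)) :
    besselMul t G =ᵐ[volume] fun ξ => (jap (-t) ξ : ℂ) * G ξ := by
  filter_upwards [(ContinuousLinearMap.mul ℂ ℂ).coeFn_holder (r := 2)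
    (memLp_jap_neg_abs t).toLp G, (memLp_jap_neg_abs (E := E) t).coeFn_toLp] with ξ h1 h2
  have h3 : jap (-|t|) ξ = jap (-t) ξ := by rw [abs_of_nonneg ht]
  rw [h3] at h2
  change (ContinuousLinearMap.mul ℂ ℂ).holder 2 (memLp_jap_neg_abs t).toLp G ξ = _
  rw [h1, h2]; rfl

/-- On `L¹ ∩ L²` the inverse Fourier transform of `L²` is the inverse Fourier integral. -/
lemma coeFn_fourierInv_eq_integral (F : Lp ℂ 2 (volume : Measure E)) (hF : Integrable F) :
    (𝓕⁻ F : Lp ℂ 2 (volume : Measure E)) =ᵐ[volume] (𝓕⁻ (F : E → ℂ)) := by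
  have hc : Continuous (𝓕⁻ (F : E → ℂ)) := by
    rw [← Real.Lp.fourierTransformInv_toLp (memLp_one_iff_integrable.mpr hF)]
    exact BoundedContinuousFunction.continuous _
  -- Against a bump function both sides become the pairing of `F` with the inverse transform of the
  -- bump: the `L²` side by duality of tempered distributions, the integral side by Fubini.
  refine ae_eq_of_integral_contDiff_smul_eq ((Lp.memLp _).locallyIntegrable (by norm_num))
    hc.locallyIntegrable fun g hg hgc => ?_
  have hg₁ : HasCompactSupport (Complex.ofRealCLM ∘ g) := hgc.comp_left rfl
  have hg₂ : ContDiff ℝ ∞ (Complex.ofRealCLM ∘ g) := by fun_prop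
  set φ : 𝓢(E, ℂ) := hg₁.toSchwartzMap hg₂ with hφ
  have e1 := congrArg (fun T : 𝓢'(E, ℂ) => T φ) (Lp.fourierInv_toTemperedDistribution_eq F)
  simp only [TemperedDistribution.fourierInv_apply, Lp.toTemperedDistribution_apply] at e1
  have e2 := VectorFourier.integral_fourierIntegral_smul_eq_flip (μ := (volume : Measure E))
    (ν := (volume : Measure E)) (f := (φ : E → ℂ)) (g := (F : E → ℂ)) (L := -innerₗ E)
    Real.continuous_fourierChar (continuous_inner.neg) φ.integrable hF
  have hflip : (-innerₗ E).flip = -innerₗ E := by ext; simp [real_inner_comm]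
  rw [hflip] at e2
  calc ∫ x, g x • (𝓕⁻ F : Lp ℂ 2 (volume : Measure E)) x
      = ∫ x, φ x • (𝓕⁻ F : Lp ℂ 2 (volume : Measure E)) x := by rfl
    _ = ∫ x, (𝓕⁻ φ) x • F x := e1.symm
    _ = ∫ x, (𝓕⁻ (φ : E → ℂ)) x • F x := by rw [SchwartzMap.fourierInv_coe]
    _ = ∫ x, φ x • (𝓕⁻ (F : E → ℂ)) x := e2
    _ = _ := by rfl

lemma norm_fourierInv_le_integral (F : Lp ℂ 2 (volume : Measure E)) (hF : Integrable F) :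
    ∀ᵐ x, ‖(𝓕⁻ F : Lp ℂ 2 (volume : Measure E)) x‖ ≤ ∫ ξ, ‖F ξ‖ := by
  filter_upwards [coeFn_fourierInv_eq_integral F hF] with x hx
  rw [hx]
  exact VectorFourier.norm_fourierIntegral_le_integral_norm _ _ _ _ _

lemma setIntegral_closedBall_norm_rpow {a : ℝ} {A : ℝ} (hA : 0 < A) :
    ∫ ξ in Metric.closedBall (0 : E) A, ‖ξ‖ ^ (-a) =
      A ^ ((Module.finrank ℝ E : ℝ) - a) * ∫ ξ in Metric.closedBall (0 : E) 1, ‖ξ‖ ^ (-a) := by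
  have h := Measure.setIntegral_comp_smul_of_pos (volume : Measure E) (fun ξ : E => ‖ξ‖ ^ (-a))
    (Metric.closedBall 0 1) hA
  rw [smul_closedBall _ _ zero_le_one, smul_zero, Real.norm_of_nonneg hA.le, mul_one] at h
  simp_rw [norm_smul, Real.norm_of_nonneg hA.le, Real.mul_rpow hA.le (norm_nonneg _)] at h
  rw [integral_const_mul, smul_eq_mul] at h
  rw [sub_eq_add_neg, Real.rpow_add hA, mul_assoc, h, Real.rpow_natCast]
  field_simp

lemma integrableOn_closedBall_norm_rpow {a : ℝ} (ha : a < Module.finrank ℝ E)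
    (hd : 1 ≤ Module.finrank ℝ E) (A : ℝ) :
    IntegrableOn (fun ξ : E => ‖ξ‖ ^ (-a)) (Metric.closedBall 0 A) := by
  refine (integrableOn_ball_of_norm_le_rpow (C := 1) (r := A + 1) hd ha ?_ ?_).mono_set
    (Metric.closedBall_subset_ball (by linarith))
  · refine .of_forall fun ξ => ?_
    rw [Real.norm_of_nonneg (by positivity), one_mul]
  · exact Measurable.aestronglyMeasurable (by fun_prop)

/-- The low frequency part in the proof of the Sobolev embedding. -/
lemma integral_low_frequency_le {t : ℝ} (ht : 0 < t) (htd : 2 * t < Module.finrank ℝ E)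
    (G : Lp ℂ 2 (volume : Measure E)) {A : ℝ} (hA : 0 < A) :
    IntegrableOn (besselMul t G) (Metric.closedBall 0 A) ∧
    ∫ ξ in Metric.closedBall (0 : E) A, ‖besselMul t G ξ‖ ≤
      (∫ ξ in Metric.closedBall (0 : E) 1, ‖ξ‖ ^ (-(2 * t))) ^ (1 / 2 : ℝ) * ‖G‖ *
        A ^ (((Module.finrank ℝ E : ℝ) - 2 * t) / 2) := by
  have hd : 1 ≤ Module.finrank ℝ E := by
    have : (0 : ℝ) < Module.finrank ℝ E := by linarith
    exact_mod_cast this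
  have hnt : Nontrivial E := Module.nontrivial_of_finrank_pos (R := ℝ) hd
  -- The condition `2 * t < d` makes `‖ξ‖ ^ (-t)` square integrable near the origin; Cauchy–Schwarz
  -- and scaling then give the power of `A`.
  have h2 : MemLp (fun ξ : E => ‖ξ‖ ^ (-t)) (ENNReal.ofReal 2)
      (volume.restrict (Metric.closedBall 0 A)) := by
    rw [show ENNReal.ofReal 2 = 2 by simp, memLp_two_iff_integrable_sq_norm
      (Measurable.aestronglyMeasurable (by fun_prop))]
    refine (integrableOn_closedBall_norm_rpow htd hd A).congr (.of_forall fun ξ => ?_)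
    simp only
    rw [Real.norm_of_nonneg (by positivity), ← Real.rpow_natCast, ← Real.rpow_mul (norm_nonneg _)]
    congr 1; push_cast; ring
  have hG : MemLp G (ENNReal.ofReal 2) (volume.restrict (Metric.closedBall 0 A)) := by
    rw [show ENNReal.ofReal 2 = 2 by simp]
    exact (Lp.memLp G).restrict _
  have hle : ∀ᵐ ξ ∂(volume.restrict (Metric.closedBall (0 : E) A)),
      ‖besselMul t G ξ‖ ≤ ‖ξ‖ ^ (-t) * ‖G ξ‖ := by
    refine ae_restrict_of_ae ?_
    filter_upwards [coeFn_besselMul ht.le G, Measure.ae_ne volume (0 : E)] with ξ h h0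
    rw [h, norm_mul, Complex.norm_real, Real.norm_of_nonneg (jap_pos _ _).le]
    gcongr
    exact jap_neg_le ht.le h0
  have hint : Integrable (fun ξ => ‖ξ‖ ^ (-t) * ‖G ξ‖)
      (volume.restrict (Metric.closedBall (0 : E) A)) := by
    rw [show ENNReal.ofReal 2 = 2 by simp] at h2 hG
    exact h2.integrable_mul hG.norm
  refine ⟨hint.mono' (Lp.aestronglyMeasurable _).restrict hle, ?_⟩
  calc ∫ ξ in Metric.closedBall (0 : E) A, ‖besselMul t G ξ‖
      ≤ ∫ ξ in Metric.closedBall (0 : E) A, ‖ξ‖ ^ (-t) * ‖G ξ‖ :=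
        integral_mono_of_nonneg (.of_forall fun _ => norm_nonneg _) hint hle
    _ ≤ (∫ ξ in Metric.closedBall (0 : E) A, (‖ξ‖ ^ (-t)) ^ (2 : ℝ)) ^ (1 / 2 : ℝ) *
          (∫ ξ in Metric.closedBall (0 : E) A, ‖G ξ‖ ^ (2 : ℝ)) ^ (1 / 2 : ℝ) :=
        integral_mul_le_Lp_mul_Lq_of_nonneg Real.HolderConjugate.two_two
          (.of_forall fun _ => by positivity) (.of_forall fun _ => norm_nonneg _) h2 hG.norm
    _ ≤ (A ^ ((Module.finrank ℝ E : ℝ) - 2 * t) *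
          ∫ ξ in Metric.closedBall (0 : E) 1, ‖ξ‖ ^ (-(2 * t))) ^ (1 / 2 : ℝ) * ‖G‖ := by
        have e1 : ∀ ξ : E, (‖ξ‖ ^ (-t)) ^ (2 : ℝ) = ‖ξ‖ ^ (-(2 * t)) := fun ξ => by
          rw [← Real.rpow_mul (norm_nonneg _)]; ring_nf
        simp_rw [e1]
        rw [setIntegral_closedBall_norm_rpow hA]
        gcongr
        have e2 : ∫ ξ, ‖G ξ‖ ^ (2 : ℝ) = ‖G‖ ^ (2 : ℝ) := by
          have := L2.inner_def (𝕜 := ℂ) G G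
          rw [inner_self_eq_norm_sq_to_K] at this
          simp_rw [inner_self_eq_norm_sq_to_K] at this
          simp_rw [Real.rpow_two]
          have h4 : ((‖G‖ ^ 2 : ℝ) : ℂ) = ((∫ ξ, ‖G ξ‖ ^ 2 : ℝ) : ℂ) := by
            rw [← integral_complex_ofReal]; push_cast; exact this
          exact_mod_cast h4.symm
        calc (∫ ξ in Metric.closedBall (0 : E) A, ‖G ξ‖ ^ (2 : ℝ)) ^ (1 / 2 : ℝ)
            ≤ (∫ ξ, ‖G ξ‖ ^ (2 : ℝ)) ^ (1 / 2 : ℝ) := by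
              refine Real.rpow_le_rpow (integral_nonneg fun _ => by positivity)
                (setIntegral_le_integral ?_ (.of_forall fun _ => by positivity)) (by norm_num)
              simp_rw [Real.rpow_two]
              exact (memLp_two_iff_integrable_sq_norm (Lp.aestronglyMeasurable _)).mp (Lp.memLp G)
          _ = ‖G‖ := by
              rw [e2, ← Real.rpow_mul (norm_nonneg _)]; norm_num
    _ = _ := by
        have : 0 ≤ ∫ ξ in Metric.closedBall (0 : E) 1, ‖ξ‖ ^ (-(2 * t)) :=
          integral_nonneg fun _ => by positivity
        rw [Real.mul_rpow (by positivity) this, ← Real.rpow_mul hA.le]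
        ring_nf

lemma lintegral_enorm_rpow_two_eq (F : Lp ℂ 2 (volume : Measure E)) :
    ∫⁻ x, ‖F x‖ₑ ^ (2 : ℝ) = ENNReal.ofReal (‖F‖ ^ (2 : ℝ)) := by
  have h := eLpNorm_eq_lintegral_rpow_enorm_toReal (μ := (volume : Measure E)) (f := F) (p := 2)
    (by norm_num) (by norm_num)
  rw [← Lp.enorm_def, ENNReal.toReal_ofNat] at h
  rw [← ENNReal.ofReal_rpow_of_nonneg (norm_nonneg _) (by norm_num), ofReal_norm, h,
    ← ENNReal.rpow_mul]
  norm_num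

/-- The splitting of frequencies at `‖ξ‖ = A`. -/
lemma exists_split_fourierInv_besselMul {t : ℝ} (ht : 0 < t) (htd : 2 * t < Module.finrank ℝ E)
    (G : Lp ℂ 2 (volume : Measure E)) {A : ℝ} (hA : 0 < A) :
    ∃ F₁ F₂ : E → ℂ, (𝓕⁻ (besselMul t G) : Lp ℂ 2 (volume : Measure E)) =ᵐ[volume] F₁ + F₂ ∧
      (∀ᵐ x, ‖F₁ x‖ ≤ (∫ ξ in Metric.closedBall (0 : E) 1, ‖ξ‖ ^ (-(2 * t))) ^ (1 / 2 : ℝ) * ‖G‖ *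
        A ^ (((Module.finrank ℝ E : ℝ) - 2 * t) / 2)) ∧
      AEStronglyMeasurable F₂ ∧ ∫⁻ x, ‖F₂ x‖ₑ ^ (2 : ℝ) ≤
        ∫⁻ ξ, {ξ : E | A < ‖ξ‖}.indicator
          (fun ξ => ENNReal.ofReal (‖ξ‖ ^ (-(2 * t))) * ‖G ξ‖ₑ ^ (2 : ℝ)) ξ := by
  set M := besselMul t G with hM
  have hB : MeasurableSet (Metric.closedBall (0 : E) A) := measurableSet_closedBall
  have hm1 := (Lp.memLp M).indicator hB
  have hm2 := (Lp.memLp M).indicator hB.compl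
  set M₁ := hm1.toLp with hM₁
  set M₂ := hm2.toLp with hM₂
  have hsum : M = M₁ + M₂ := by
    apply Lp.ext
    filter_upwards [hm1.coeFn_toLp, hm2.coeFn_toLp, Lp.coeFn_add M₁ M₂] with x h1 h2 h3
    rw [h3, Pi.add_apply, h1, h2, ← Pi.add_apply, Set.indicator_self_add_compl]
  obtain ⟨hi, hle⟩ := integral_low_frequency_le ht htd G hA
  have hi1 : Integrable M₁ := by
    rw [integrable_congr hm1.coeFn_toLp, integrable_indicator_iff hB]; exact hi
  refine ⟨(𝓕⁻ M₁ : Lp ℂ 2 (volume : Measure E)), (𝓕⁻ M₂ : Lp ℂ 2 (volume : Measure E)),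
    ?_, ?_, Lp.aestronglyMeasurable _, ?_⟩
  · rw [hsum, FourierTransform.fourierInv_add]
    exact Lp.coeFn_add _ _
  · have e : ∫ ξ, ‖M₁ ξ‖ = ∫ ξ in Metric.closedBall (0 : E) A, ‖M ξ‖ := by
      rw [← integral_indicator hB]
      apply integral_congr_ae
      filter_upwards [hm1.coeFn_toLp] with x h1
      rw [h1, norm_indicator_eq_indicator_norm]
    filter_upwards [norm_fourierInv_le_integral M₁ hi1] with x hx
    exact hx.trans (e.trans_le hle)
  · have e : ‖(𝓕⁻ M₂ : Lp ℂ 2 (volume : Measure E))‖ = ‖M₂‖ :=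
      (Lp.fourierTransformₗᵢ E ℂ).symm.norm_map M₂
    rw [lintegral_enorm_rpow_two_eq, e, ← lintegral_enorm_rpow_two_eq]
    apply lintegral_mono_ae
    filter_upwards [hm2.coeFn_toLp, coeFn_besselMul ht.le G] with ξ h1 h2
    rw [h1]
    by_cases h : A < ‖ξ‖
    · rw [Set.indicator_of_mem (by simpa using h),
        Set.indicator_of_mem (show ξ ∈ {ξ : E | A < ‖ξ‖} from h), hM, h2, enorm_mul, ENNReal.mul_rpow_of_nonneg _ _ (by norm_num)]
      gcongr
      rw [← ofReal_norm, Complex.norm_real, Real.norm_of_nonneg (jap_pos _ _).le,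
        ENNReal.ofReal_rpow_of_pos (jap_pos _ _)]
      apply ENNReal.ofReal_le_ofReal
      have h0 : ξ ≠ 0 := norm_pos_iff.mp (hA.trans h)
      calc jap (-t) ξ ^ (2 : ℝ) ≤ (‖ξ‖ ^ (-t)) ^ (2 : ℝ) :=
            Real.rpow_le_rpow (jap_pos _ _).le (jap_neg_le ht.le h0) (by norm_num)
        _ = _ := by rw [← Real.rpow_mul (norm_nonneg _)]; ring_nf
    · rw [Set.indicator_of_notMem (by simpa using h)]
      simp

/-- The exponent `p` with `1 / p = 1 / 2 - t / d`. -/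
noncomputable def sobolevExponent (d t : ℝ) : ℝ≥0∞ := ENNReal.ofReal (d / (d / 2 - t))

/-- The Sobolev embedding of `H^t` into `L^p` with the critical exponent `1 / p = 1 / 2 - t / d`. -/
theorem exists_eLpNorm_fourierInv_besselMul_le {t : ℝ} (ht : 0 < t)
    (htd : 2 * t < Module.finrank ℝ E) :
    ∃ C : ℝ, 0 ≤ C ∧ ∀ G : Lp ℂ 2 (volume : Measure E),
      eLpNorm (𝓕⁻ (besselMul t G) : Lp ℂ 2 (volume : Measure E))
        (sobolevExponent (Module.finrank ℝ E) t) volume ≤ ENNReal.ofReal (C * ‖G‖) := by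
  set d : ℝ := (Module.finrank ℝ E : ℝ) with hd
  have hd0 : 0 < d := by linarith
  have hdt : 0 < d / 2 - t := by linarith
  have hnt : Nontrivial E := Module.nontrivial_of_finrank_pos (R := ℝ) (by rw [hd] at hd0; exact_mod_cast hd0)
  set I : ℝ := (∫ ξ in Metric.closedBall (0 : E) 1, ‖ξ‖ ^ (-(2 * t))) ^ (1 / 2 : ℝ) with hI
  have hI0 : 0 ≤ I := Real.rpow_nonneg (integral_nonneg fun _ => by positivity) _
  set p : ℝ := d / (d / 2 - t) with hp
  have hp2 : 2 < p := by rw [hp, lt_div_iff₀ hdt]; linarith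
  have hp0 : 0 < p := by linarith
  have hrp : ((d - 2 * t) / 2) * (p - 2) = 2 * t := by
    have e : d = p * (d / 2 - t) := by
      rw [hp, div_mul_cancel₀ _ hdt.ne']
    linear_combination (-1) * e
  set c : ℝ := p * (4 * ((2 * (I + 1)) ^ (p - 2) / (p - 2))) with hc
  have hc0 : 0 < c := by
    have : 0 < p - 2 := by linarith
    positivity
  refine ⟨c ^ p⁻¹, by positivity, fun G => ?_⟩
  -- The interpolation lemma needs `K > 0`: hence the separate case `G = 0`, and `I + 1` in place of
  -- `I`.
  rcases eq_or_ne G 0 with rfl | hG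
  · rw [map_zero, FourierTransform.fourierInv_zero, eLpNorm_congr_ae (Lp.coeFn_zero _ _ _)]
    simp
  have hG' : 0 < ‖G‖ := norm_pos_iff.mpr hG
  have key := lintegral_rpow_le_of_split (μ := (volume : Measure E)) (K := (I + 1) * ‖G‖)
    (r := (d - 2 * t) / 2) (p := p) (a := 2 * t)
    (F := (𝓕⁻ (besselMul t G) : Lp ℂ 2 (volume : Measure E))) (G := G) (by positivity)
    (by linarith) hp2 hrp (Lp.aestronglyMeasurable _) (Lp.aestronglyMeasurable _)
    (measure_singleton _) (fun A hA => by
      obtain ⟨F₁, F₂, h1, h2, h3, h4⟩ := exists_split_fourierInv_besselMul ht htd G hA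
      refine ⟨F₁, F₂, h1, ?_, h3, h4⟩
      filter_upwards [h2] with x hx
      refine hx.trans ?_
      gcongr
      linarith)
  rw [lintegral_enorm_rpow_two_eq] at key
  rw [sobolevExponent, ← hp, eLpNorm_eq_lintegral_rpow_enorm_toReal (by simpa using hp0) (by simp),
    ENNReal.toReal_ofReal hp0.le]
  have e1 : ∀ x : ℂ, ‖x‖ₑ ^ p = ENNReal.ofReal (‖x‖ ^ p) := fun x => by
    rw [← ENNReal.ofReal_rpow_of_nonneg (norm_nonneg _) hp0.le, ofReal_norm]
  simp_rw [e1]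
  rw [← ENNReal.ofReal_mul (by have : 0 < p - 2 := by linarith
                               positivity)] at key
  calc _ ≤ (ENNReal.ofReal (p * (4 * ((2 * ((I + 1) * ‖G‖)) ^ (p - 2) / (p - 2))) *
        ‖G‖ ^ (2 : ℝ))) ^ (1 / p) := by gcongr
    _ = ENNReal.ofReal ((c * ‖G‖ ^ p) ^ (1 / p)) := by
        rw [ENNReal.ofReal_rpow_of_nonneg _ (by positivity)]
        · congr 2
          rw [hc, ← mul_assoc 2 (I + 1), Real.mul_rpow (by positivity) hG'.le,
            show ‖G‖ ^ p = ‖G‖ ^ (p - 2) * ‖G‖ ^ (2 : ℝ) by rw [← Real.rpow_add hG']; ring_nf]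
          ring
        · have : 0 < p - 2 := by linarith
          positivity
    _ = _ := by
        rw [Real.mul_rpow hc0.le (by positivity), ← Real.rpow_mul hG'.le, one_div,
          mul_inv_cancel₀ hp0.ne', Real.rpow_one]

end Bessel

/-! ### Schur's test for kernels dominated by a convolution -/

section Schur

variable {E : Type*} [NormedAddCommGroup E] [InnerProductSpace ℝ E] [FiniteDimensional ℝ E]
  [MeasurableSpace E] [BorelSpace E]

lemma lintegral_enorm_rpow_two_lt_top {X : E → ℂ} (hX : MemLp X 2) :
    ∫⁻ x, ‖X x‖ₑ ^ (2 : ℝ) < (⊤ : ℝ≥0∞) := by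
  have := lintegral_rpow_enorm_lt_top_of_eLpNorm_lt_top (by norm_num) (by norm_num) hX.2
  simpa using this

lemma lintegral_convolution_kernel_mul {κ : E → ℝ≥0∞} (hκ : Measurable κ) (w : E → ℝ≥0∞) 
    (hw : AEMeasurable w) :
    ∫⁻ ξ, ∫⁻ η, κ (η - ξ) * w η = (∫⁻ ζ, κ ζ) * ∫⁻ η, w η := by
  rw [lintegral_lintegral_swap]
  · have h : ∀ η, ∫⁻ ξ, κ (η - ξ) * w η = (∫⁻ ζ, κ ζ) * w η := fun η => by
      rw [lintegral_mul_const (w η) (by fun_prop), lintegral_sub_left_eq_self κ η]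
    simp_rw [h]
    rw [lintegral_const_mul'' _ hw]
  · exact ((hκ.comp (measurable_snd.sub measurable_fst)).aemeasurable).mul hw.comp_snd

/-- A kernel dominated by an integrable convolution kernel pairs `L²` functions integrably. -/
lemma integrable_kernel_pairing {κ : E → ℝ} (hκ : Integrable κ) (hκm : Measurable κ)
    {K : E → E → ℂ} (hK : Continuous (Function.uncurry K))
    (hb : ∀ ξ η, ‖K ξ η‖ ≤ κ (η - ξ)) {X G : E → ℂ} (hX : MemLp X 2) (hG : MemLp G 2) :
    Integrable (fun p : E × E => X p.1 * (K p.1 p.2 * G p.2)) (volume.prod volume) := by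
  refine ⟨hX.1.comp_fst.mul (hK.aestronglyMeasurable.mul hG.1.comp_snd), ?_⟩
  have hκm' : Measurable fun ζ => ‖κ ζ‖ₑ := hκm.enorm
  have hfin := hκ.2
  have hX2 := lintegral_enorm_rpow_two_lt_top hX
  have hG2 := lintegral_enorm_rpow_two_lt_top hG
  have hXm := hX.1.enorm.pow_const (2 : ℝ)
  have hGm := hG.1.enorm.pow_const (2 : ℝ)
  have hsub : Measurable fun p : E × E => ‖κ (p.2 - p.1)‖ₑ :=
    hκm'.comp (measurable_snd.sub measurable_fst)
  have aX : AEMeasurable (fun p : E × E => ‖κ (p.2 - p.1)‖ₑ * ‖X p.1‖ₑ ^ (2 : ℝ))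
    (volume.prod volume) := hsub.aemeasurable.mul hXm.comp_fst
  have aG : AEMeasurable (fun p : E × E => ‖κ (p.2 - p.1)‖ₑ * ‖G p.2‖ₑ ^ (2 : ℝ))
    (volume.prod volume) := hsub.aemeasurable.mul hGm.comp_snd
  calc ∫⁻ p, ‖X p.1 * (K p.1 p.2 * G p.2)‖ₑ ∂(volume.prod volume)
      ≤ ∫⁻ p : E × E, (‖κ (p.2 - p.1)‖ₑ * ‖X p.1‖ₑ ^ (2 : ℝ) +
          ‖κ (p.2 - p.1)‖ₑ * ‖G p.2‖ₑ ^ (2 : ℝ)) ∂(volume.prod volume) := by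
        apply lintegral_mono
        intro p
        simp only
        rw [← mul_add, enorm_mul, enorm_mul, mul_left_comm]
        gcongr
        · rw [← ofReal_norm, ← ofReal_norm]
          apply ENNReal.ofReal_le_ofReal
          exact (hb _ _).trans (le_abs_self _)
        · simp_rw [ENNReal.rpow_two, sq]
          rcases le_total ‖X p.1‖ₑ ‖G p.2‖ₑ with h | h
          · exact le_add_left (by gcongr)
          · exact le_add_right (by gcongr)
    _ = (∫⁻ p : E × E, ‖κ (p.2 - p.1)‖ₑ * ‖X p.1‖ₑ ^ (2 : ℝ) ∂(volume.prod volume)) +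
          ∫⁻ p : E × E, ‖κ (p.2 - p.1)‖ₑ * ‖G p.2‖ₑ ^ (2 : ℝ) ∂(volume.prod volume) :=
        lintegral_add_left' aX _
    _ = (∫⁻ ζ, ‖κ ζ‖ₑ) * (∫⁻ ξ, ‖X ξ‖ₑ ^ (2 : ℝ)) + (∫⁻ ζ, ‖κ ζ‖ₑ) * ∫⁻ η, ‖G η‖ₑ ^ (2 : ℝ) := by
        rw [lintegral_prod _ aX, lintegral_prod _ aG]
        congr 1
        · have h : ∀ ξ, ∫⁻ η, ‖κ (η - ξ)‖ₑ * ‖X ξ‖ₑ ^ (2 : ℝ) =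
              (∫⁻ ζ, ‖κ ζ‖ₑ) * ‖X ξ‖ₑ ^ (2 : ℝ) := fun ξ => by
            rw [lintegral_mul_const _ (by fun_prop),
              lintegral_sub_right_eq_self (fun ζ => ‖κ ζ‖ₑ) ξ]
          simp_rw [h]
          rw [lintegral_const_mul'' _ hXm]
        · exact lintegral_convolution_kernel_mul hκm' _ hGm
    _ < (⊤ : ℝ≥0∞) := ENNReal.add_lt_top.mpr ⟨ENNReal.mul_lt_top hfin hX2, ENNReal.mul_lt_top hfin hG2⟩

/-- A kernel dominated by an integrable convolution kernel maps `L²` to `L²`. -/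
lemma memLp_integral_kernel {κ : E → ℝ} (hκ : Integrable κ) (hκm : Measurable κ)
    {K : E → E → ℂ} (hK : Continuous (Function.uncurry K))
    (hb : ∀ ξ η, ‖K ξ η‖ ≤ κ (η - ξ)) {G : E → ℂ} (hG : MemLp G 2) :
    MemLp (fun ξ => ∫ η, K ξ η * G η) 2 := by
  have hm : AEStronglyMeasurable (fun p : E × E => K p.1 p.2 * G p.2) (volume.prod volume) :=
    hK.aestronglyMeasurable.mul hG.1.comp_snd
  refine ⟨hm.integral_prod_right', ?_⟩
  rw [eLpNorm_lt_top_iff_lintegral_rpow_enorm_lt_top (by norm_num) (by norm_num),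
    ENNReal.toReal_ofNat]
  have hκm' : Measurable fun ζ => ‖κ ζ‖ₑ := hκm.enorm
  have hG2 := lintegral_enorm_rpow_two_lt_top hG
  have hGm := hG.1.enorm.pow_const (2 : ℝ)
  calc ∫⁻ ξ, ‖∫ η, K ξ η * G η‖ₑ ^ (2 : ℝ)
      ≤ ∫⁻ ξ, (∫⁻ ζ, ‖κ ζ‖ₑ) * ∫⁻ η, ‖κ (η - ξ)‖ₑ * ‖G η‖ₑ ^ (2 : ℝ) := by
        apply lintegral_mono
        intro ξ
        have hsub : Measurable fun η => ‖κ (η - ξ)‖ₑ := hκm'.comp (measurable_id.sub measurable_const)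
        -- Cauchy–Schwarz with the dominating kernel split as a product of its square roots.
        calc ‖∫ η, K ξ η * G η‖ₑ ^ (2 : ℝ)
            ≤ (∫⁻ η, ‖κ (η - ξ)‖ₑ ^ (1 / 2 : ℝ) *
                (‖κ (η - ξ)‖ₑ ^ (1 / 2 : ℝ) * ‖G η‖ₑ)) ^ (2 : ℝ) := by
              gcongr
              refine (enorm_integral_le_lintegral_enorm _).trans (lintegral_mono fun η => ?_)
              rw [← mul_assoc, ← ENNReal.rpow_add_of_nonneg _ _ (by norm_num) (by norm_num),
                enorm_mul]
              norm_num
              gcongr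
              rw [← ofReal_norm, ← ofReal_norm]
              exact ENNReal.ofReal_le_ofReal ((hb _ _).trans (le_abs_self _))
          _ ≤ ((∫⁻ η, (‖κ (η - ξ)‖ₑ ^ (1 / 2 : ℝ)) ^ (2 : ℝ)) ^ (1 / 2 : ℝ) *
                (∫⁻ η, (‖κ (η - ξ)‖ₑ ^ (1 / 2 : ℝ) * ‖G η‖ₑ) ^ (2 : ℝ)) ^ (1 / 2 : ℝ)) ^ (2 : ℝ) := by
              gcongr
              exact ENNReal.lintegral_mul_le_Lp_mul_Lq _ Real.HolderConjugate.two_two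
                (hsub.pow_const _).aemeasurable
                ((hsub.pow_const _).aemeasurable.mul hG.1.enorm)
          _ = _ := by
              rw [ENNReal.mul_rpow_of_nonneg _ _ (by norm_num), ← ENNReal.rpow_mul,
                ← ENNReal.rpow_mul]
              simp_rw [ENNReal.mul_rpow_of_nonneg _ _ (show (0 : ℝ) ≤ 2 by norm_num),
                ← ENNReal.rpow_mul]
              norm_num
              rw [lintegral_sub_right_eq_self (fun ζ => ‖κ ζ‖ₑ) ξ]
    _ = (∫⁻ ζ, ‖κ ζ‖ₑ) * ((∫⁻ ζ, ‖κ ζ‖ₑ) * ∫⁻ η, ‖G η‖ₑ ^ (2 : ℝ)) := by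
        rw [lintegral_const_mul' _ _ hκ.2.ne, lintegral_convolution_kernel_mul hκm' _ hGm]
    _ < (⊤ : ℝ≥0∞) := ENNReal.mul_lt_top hκ.2 (ENNReal.mul_lt_top hκ.2 hG2)

/-- Fubini's theorem for the pairing of a kernel with two `L²` functions. -/
lemma integral_kernel_pairing_swap {κ : E → ℝ} (hκ : Integrable κ) (hκm : Measurable κ)
    {K : E → E → ℂ} (hK : Continuous (Function.uncurry K))
    (hb : ∀ ξ η, ‖K ξ η‖ ≤ κ (η - ξ)) {X G : E → ℂ} (hX : MemLp X 2) (hG : MemLp G 2) :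
    ∫ ξ, X ξ * ∫ η, K ξ η * G η = ∫ η, (∫ ξ, X ξ * K ξ η) * G η := by
  have h := integral_integral_swap (f := fun ξ η => X ξ * (K ξ η * G η)) (integrable_kernel_pairing hκ hκm hK hb hX hG)
  simp_rw [← integral_const_mul, ← integral_mul_const, mul_assoc]
  exact h

lemma integrable_integral_kernel_mul {κ : E → ℝ} (hκ : Integrable κ) (hκm : Measurable κ)
    {K : E → E → ℂ} (hK : Continuous (Function.uncurry K))
    (hb : ∀ ξ η, ‖K ξ η‖ ≤ κ (η - ξ)) {X G : E → ℂ} (hX : MemLp X 2) (hG : MemLp G 2) :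
    Integrable (fun η => (∫ ξ, X ξ * K ξ η) * G η) := by
  have h := (integrable_kernel_pairing hκ hκm hK hb hX hG).integral_prod_right
  simp_rw [← integral_mul_const, mul_assoc]
  exact h

end Schur

/-! ### Symbol estimates for the commutator -/

section KernelBounds

/-- Dividing by `b ^ c` leaves `1 - q ^ c ≤ max 1 c * (1 - q)` on `[0, 1]`: Bernoulli's inequality
for `c ≥ 1`, and `q ≤ q ^ c` for `c ≤ 1`. -/
lemma rpow_sub_rpow_le {a b c : ℝ} (hc : 0 < c) (ha : 0 ≤ a) (hab : a ≤ b) (hb : 0 < b) :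
    b ^ c - a ^ c ≤ max 1 c * (b - a) * b ^ (c - 1) := by
  set q := a / b with hq
  have hq0 : 0 ≤ q := by positivity
  have hq1 : q ≤ 1 := (div_le_one hb).mpr hab
  have haq : a = q * b := by rw [hq]; field_simp
  have h : 1 - q ^ c ≤ max 1 c * (1 - q) := by
    rcases le_total 1 c with h1 | h1
    · have := one_add_mul_self_le_rpow_one_add (s := q - 1) (by linarith) h1
      rw [add_sub_cancel] at this
      rw [max_eq_right h1]; linarith
    · have := Real.rpow_le_rpow_of_exponent_ge' hq0 hq1 hc.le h1
      rw [Real.rpow_one] at this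
      rw [max_eq_left h1]; linarith
  rw [haq, Real.mul_rpow hq0 hb.le, show b ^ c = b * b ^ (c - 1) by
    rw [mul_comm, ← Real.rpow_add_one hb.ne', sub_add_cancel]]
  have hb' : 0 < b * b ^ (c - 1) := by positivity
  nlinarith [mul_le_mul_of_nonneg_right h hb'.le]

/-- Used with `x = ⟨ξ⟩`, `z = ‖η‖`, `D = ⟨η - ξ⟩`. The previous bound involves the larger of `x` and
`z`; if that is `z`, then writing `z ^ (c - 1) = z ^ c / z` and using `x ≤ z ≤ 3 D x` returns to
`x`, whatever the sign of `c - 1`. -/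
lemma abs_rpow_sub_rpow_le {x z D c : ℝ} (hc : 0 < c) (hx : 1 ≤ x) (hz : 0 ≤ z) (hD : 1 ≤ D)
    (h₁ : x ≤ z + 2 * D) (h₂ : z ≤ x + D) :
    |x ^ c - z ^ c| ≤ max 1 c * (3 * D) ^ (c + 1) * x ^ (c - 1) := by
  have hx0 : 0 < x := by linarith
  have hm : 1 ≤ max 1 c := le_max_left _ _
  have hD3 : 1 ≤ (3 * D) ^ c := Real.one_le_rpow (by linarith) hc.le
  rw [Real.rpow_add_one (by positivity)]
  rcases le_total z x with h | h
  · rw [abs_of_nonneg (sub_nonneg.mpr (Real.rpow_le_rpow hz h hc.le))]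
    refine (rpow_sub_rpow_le hc hz h hx0).trans ?_
    gcongr
    nlinarith
  · rw [abs_sub_comm, abs_of_nonneg (sub_nonneg.mpr (Real.rpow_le_rpow hx0.le h hc.le))]
    have hz0 : 0 < z := by linarith
    refine (rpow_sub_rpow_le hc hx0.le h hz0).trans ?_
    have h3 : z ^ (c - 1) ≤ (3 * D) ^ c * x ^ (c - 1) := by
      rw [Real.rpow_sub_one hz0.ne', Real.rpow_sub_one hx0.ne', ← mul_div_assoc,
        ← Real.mul_rpow (by positivity) hx0.le]
      gcongr
      nlinarith
    calc max 1 c * (z - x) * z ^ (c - 1)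
        ≤ max 1 c * (3 * D) * ((3 * D) ^ c * x ^ (c - 1)) := by
          gcongr
          · linarith
      _ = _ := by ring

variable {E : Type*} [NormedAddCommGroup E]

lemma one_le_jap_one (ξ : E) : 1 ≤ jap 1 ξ :=
  Real.one_le_rpow (by simp) (by norm_num)

lemma norm_le_jap_one (ξ : E) : ‖ξ‖ ≤ jap 1 ξ := by
  rw [jap, ← Real.sqrt_eq_rpow]
  exact Real.le_sqrt_of_sq_le (by simp)

lemma jap_one_le (ξ : E) : jap 1 ξ ≤ 1 + ‖ξ‖ := by
  rw [jap, ← Real.sqrt_eq_rpow]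
  exact Real.sqrt_le_iff.mpr ⟨by positivity, by nlinarith [norm_nonneg ξ]⟩

lemma jap_eq_rpow (t : ℝ) (ξ : E) : jap t ξ = jap 1 ξ ^ t := by
  rw [jap, jap, ← Real.rpow_mul (by positivity)]; ring_nf

/-- Peetre's inequality. -/
lemma jap_mul_jap_neg_le {s : ℝ} (hs : 0 ≤ s) (ξ η : E) :
    jap s ξ * jap (-s) η ≤ 3 ^ s * jap s (η - ξ) := by
  rw [jap_neg, ← div_eq_mul_inv, div_le_iff₀ (jap_pos _ _), jap_eq_rpow s, jap_eq_rpow s (η - ξ),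
    jap_eq_rpow s η, ← Real.mul_rpow (by norm_num) (jap_pos _ _).le,
    ← Real.mul_rpow (by have := jap_pos 1 (η - ξ); positivity) (jap_pos _ _).le]
  refine Real.rpow_le_rpow (jap_pos _ _).le ?_ hs
  have h1 : ‖ξ‖ ≤ ‖η‖ + ‖η - ξ‖ := by
    have := norm_sub_le η (η - ξ); rwa [sub_sub_cancel] at this
  nlinarith [one_le_jap_one η, one_le_jap_one (η - ξ), norm_le_jap_one η, norm_le_jap_one (η - ξ),
    jap_one_le ξ]

/-- One order is gained in `ξ`, at the price of a power of `⟨η - ξ⟩` that a Schwartz kernel absorbs.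
Comparing `⟨ξ⟩ ^ c` directly with `‖η‖ ^ c` treats at once the commutator and the replacement of the
homogeneous symbol, possibly singular at the origin, by the smooth one. -/
lemma abs_jap_sub_norm_rpow_le {c : ℝ} (hc : 0 < c) (ξ η : E) :
    |jap c ξ - ‖η‖ ^ c| ≤ max 1 c * 3 ^ (c + 1) * jap (c + 1) (η - ξ) * jap (c - 1) ξ := by
  have h1 : ‖ξ‖ ≤ ‖η‖ + ‖η - ξ‖ := by
    have := norm_sub_le η (η - ξ); rwa [sub_sub_cancel] at this
  have h2 : ‖η‖ ≤ ‖ξ‖ + ‖η - ξ‖ := by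
    have := norm_add_le ξ (η - ξ); rwa [add_sub_cancel] at this
  have h := abs_rpow_sub_rpow_le hc (one_le_jap_one ξ) (norm_nonneg η) (one_le_jap_one (η - ξ))
    (by linarith [one_le_jap_one (η - ξ), norm_le_jap_one (η - ξ), jap_one_le ξ])
    (by linarith [norm_le_jap_one (η - ξ), norm_le_jap_one ξ])
  rwa [Real.mul_rpow (by norm_num) (jap_pos _ _).le, ← jap_eq_rpow, ← jap_eq_rpow, ← jap_eq_rpow,
    ← mul_assoc] at h

/-- The symbol bound behind the commutator estimate. -/
lemma commutator_symbol_le {s c ε : ℝ} (hs : 0 ≤ s) (hc : 0 < c) (hε : ε ≤ 1) (ξ η : E) :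
    jap (s - c + ε) ξ * jap (-s) η * |jap c ξ - ‖η‖ ^ c| ≤
      (max 1 c * 3 ^ (c + 1) * 3 ^ s) * jap (c + 1 + s) (η - ξ) := by
  have hp := fun (t : ℝ) (ζ : E) => (jap_pos t ζ).le
  calc jap (s - c + ε) ξ * jap (-s) η * |jap c ξ - ‖η‖ ^ c|
      ≤ jap (s - c + ε) ξ * jap (-s) η *
          (max 1 c * 3 ^ (c + 1) * jap (c + 1) (η - ξ) * jap (c - 1) ξ) := by
        have := abs_jap_sub_norm_rpow_le hc ξ η
        have := hp (s - c + ε) ξ; have := hp (-s) η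
        gcongr
    _ = max 1 c * 3 ^ (c + 1) * jap (c + 1) (η - ξ) *
          ((jap (s - c + ε) ξ * jap (c - 1) ξ) * jap (-s) η) := by ring
    _ = max 1 c * 3 ^ (c + 1) * jap (c + 1) (η - ξ) *
          (jap (ε - 1) ξ * (jap s ξ * jap (-s) η)) := by
        rw [jap_mul, ← mul_assoc (jap (ε - 1) ξ), jap_mul]; ring_nf
    -- Here `ε ≤ 1` discards `jap (ε - 1) ξ`, and Peetre's inequality moves the remaining weights
    -- onto `η - ξ`.
    _ ≤ max 1 c * 3 ^ (c + 1) * jap (c + 1) (η - ξ) * (1 * (3 ^ s * jap s (η - ξ))) := by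
        have := hp (c + 1) (η - ξ); have := hp s ξ; have := hp (-s) η
        refine mul_le_mul_of_nonneg_left ?_ (by positivity)
        exact mul_le_mul (jap_le_one (by linarith) ξ) (jap_mul_jap_neg_le hs ξ η) (by positivity)
          zero_le_one
    _ = _ := by rw [← jap_mul (c + 1) s]; ring

end KernelBounds

/-! ### Hölder exponents for a critical potential -/

section Holder

lemma holderTriple_sobolevExponent {d c t : ℝ} (hd : 0 < d) (hc : 0 < c) (ht : 2 * t < d) :
    (ENNReal.ofReal (d / c)).HolderTriple (sobolevExponent d t)
      (ENNReal.ofReal (d / (c + d / 2 - t))) := by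
  constructor
  have h1 : 0 < d / 2 - t := by linarith
  have h2 : 0 < c + d / 2 - t := by linarith
  rw [sobolevExponent, ← ENNReal.ofReal_inv_of_pos (by positivity),
    ← ENNReal.ofReal_inv_of_pos (by positivity), ← ENNReal.ofReal_inv_of_pos (by positivity),
    ← ENNReal.ofReal_add (by positivity) (by positivity)]
  congr 1
  rw [inv_div, inv_div, inv_div]; ring

/-- The reciprocal exponents of the potential and the two functions, `c / d`, `1 / 2 - t / d` and `1
/ 2 - (c - t) / d`, add up to `1` for every `t`; the same potential can thus be used at two
regularity levels. -/
lemma holderTriple_sobolevExponent_one {d c t : ℝ} (hd : 0 < d) (hc : 0 < c) (ht : 2 * t < d)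
    (hct : 2 * (c - t) < d) :
    (ENNReal.ofReal (d / (c + d / 2 - t))).HolderTriple (sobolevExponent d (c - t)) 1 := by
  constructor
  have h1 : 0 < d / 2 - (c - t) := by linarith
  have h2 : 0 < c + d / 2 - t := by linarith
  rw [sobolevExponent, ← ENNReal.ofReal_inv_of_pos (by positivity),
    ← ENNReal.ofReal_inv_of_pos (by positivity), ← ENNReal.ofReal_add (by positivity) (by positivity),
    inv_one, ← ENNReal.ofReal_one]
  congr 1
  rw [inv_div, inv_div]; field_simp; ring

variable {α : Type*} [MeasurableSpace α] {μ : Measure α}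

/-- The product has exponent `d / (c + d / 2 - t)`, which is at least `1`; finite measure then gives
integrability. -/
lemma integrable_of_potential [IsFiniteMeasure μ] {d c t : ℝ} (hd : 0 < d) (hc : 0 < c)
    (ht : 2 * t < d) (hct : 2 * (c - t) ≤ d) {W f : α → ℂ}
    (hW : MemLp W (ENNReal.ofReal (d / c)) μ) (hf : MemLp f (sobolevExponent d t) μ) :
    Integrable (fun x => W x * f x) μ := by
  have := holderTriple_sobolevExponent hd hc ht
  have h2 : 0 < c + d / 2 - t := by linarith
  refine (hf.mul hW : MemLp (W * f) (ENNReal.ofReal (d / (c + d / 2 - t))) μ).integrable ?_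
  rw [← ENNReal.ofReal_one]
  apply ENNReal.ofReal_le_ofReal
  rw [le_div_iff₀ h2]; linarith

lemma integrable_potential_pairing {d c t : ℝ} (hd : 0 < d) (hc : 0 < c)
    (ht : 2 * t < d) (hct : 2 * (c - t) < d) {W f g : α → ℂ}
    (hW : MemLp W (ENNReal.ofReal (d / c)) μ) (hf : MemLp f (sobolevExponent d t) μ)
    (hg : MemLp g (sobolevExponent d (c - t)) μ) :
    Integrable (fun x => W x * f x * g x) μ := by
  have := holderTriple_sobolevExponent hd hc ht
  have := holderTriple_sobolevExponent_one hd hc ht hct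
  have h1 : MemLp (W * f) (ENNReal.ofReal (d / (c + d / 2 - t))) μ := hf.mul hW
  exact memLp_one_iff_integrable.mp (hg.mul h1)

lemma norm_integral_potential_le {d c t : ℝ} (hd : 0 < d) (hc : 0 < c)
    (ht : 2 * t < d) (hct : 2 * (c - t) < d) {W f g : α → ℂ}
    (hW : MemLp W (ENNReal.ofReal (d / c)) μ) (hf : MemLp f (sobolevExponent d t) μ)
    (hg : MemLp g (sobolevExponent d (c - t)) μ) :
    ‖∫ x, W x * f x * g x ∂μ‖ₑ ≤ eLpNorm W (ENNReal.ofReal (d / c)) μ *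
      eLpNorm f (sobolevExponent d t) μ * eLpNorm g (sobolevExponent d (c - t)) μ := by
  have := holderTriple_sobolevExponent hd hc ht
  have := holderTriple_sobolevExponent_one hd hc ht hct
  have h1 : MemLp (W * f) (ENNReal.ofReal (d / (c + d / 2 - t))) μ := hf.mul hW
  calc ‖∫ x, W x * f x * g x ∂μ‖ₑ ≤ ∫⁻ x, ‖W x * f x * g x‖ₑ ∂μ := enorm_integral_le_lintegral_enorm _
    _ = eLpNorm ((W • f) • g) 1 μ := by rw [eLpNorm_one_eq_lintegral_enorm]; rfl
    _ ≤ eLpNorm (W • f) (ENNReal.ofReal (d / (c + d / 2 - t))) μ *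
          eLpNorm g (sobolevExponent d (c - t)) μ := eLpNorm_smul_le_mul_eLpNorm hg.1 h1.1
    _ ≤ _ := by
      gcongr
      exact eLpNorm_smul_le_mul_eLpNorm hf.1 hW.1

end Holder

/-! ### Regularity by intertwining two invertible operators -/

section Perturbation

variable {H : Type*} [NormedAddCommGroup H] [InnerProductSpace ℂ H] [CompleteSpace H]

/-- If `A` solves `(1 + P)† A = J B` and `J` intertwines `P` with another small operator `P'`,
then `A` lies in the range of `J`. -/
lemma exists_eq_of_intertwine {P P' J : H →L[ℂ] H}
    (hJ : ∀ x y, inner ℂ (J x) y = inner ℂ x (J y)) (hP : ‖P‖ < 1) (hP' : ‖P'‖ < 1)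
    (hc : ∀ x, J (P x) = P' (J x)) {A B : H}
    (h : ∀ x, inner ℂ x A + inner ℂ (P x) A = inner ℂ (J x) B) : ∃ G, A = J G := by
  have hsurj : ∀ Q : H →L[ℂ] H, ‖Q‖ < 1 → IsUnit (1 + Q) := fun Q hQ => by
    have := isUnit_one_sub_of_norm_lt_one (x := -Q) (by rwa [norm_neg])
    rwa [sub_neg_eq_add] at this
  obtain ⟨u, hu⟩ := hsurj P hP
  obtain ⟨u', hu'⟩ := hsurj P' hP'
  set R : H →L[ℂ] H := ((u'⁻¹ : (H →L[ℂ] H)ˣ) : H →L[ℂ] H)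
  -- Since `J (1 + P) = (1 + P') J`, formally `((1 + P)†)⁻¹ J = J ((1 + P')†)⁻¹`, which dictates
  -- this witness. Surjectivity of `1 + P` removes the test vectors.
  set G := ContinuousLinearMap.adjoint R B with hG
  have hR : ∀ y, R ((1 + P') y) = y := fun y => by
    have : R * (1 + P') = 1 := by rw [← hu']; exact u'.inv_mul
    exact congrArg (fun T : H →L[ℂ] H => T y) this
  have hu1 : ∀ y, (1 + P) (((u⁻¹ : (H →L[ℂ] H)ˣ) : H →L[ℂ] H) y) = y := fun y => by
    have : (1 + P) * ((u⁻¹ : (H →L[ℂ] H)ˣ) : H →L[ℂ] H) = 1 := by rw [← hu]; exact u.mul_inv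
    exact congrArg (fun T : H →L[ℂ] H => T y) this
  have key : ∀ x, inner ℂ ((1 + P) x) A = inner ℂ ((1 + P) x) (J G) := fun x => by
    have e : J ((1 + P) x) = (1 + P') (J x) := by simp [hc]
    rw [← hJ, e, hG, ContinuousLinearMap.adjoint_inner_right, hR]
    simpa [inner_add_left] using h x
  refine ⟨G, ext_inner_left ℂ fun y => ?_⟩
  rw [← hu1 y]; exact key _

end Perturbation

/-! ### Operators defined by the potential -/

section Operators

variable {E : Type*} [NormedAddCommGroup E] [InnerProductSpace ℝ E] [FiniteDimensional ℝ E]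
  [MeasurableSpace E] [BorelSpace E]

lemma besselMul_besselMul {s t : ℝ} (hs : 0 ≤ s) (ht : 0 ≤ t) (G : Lp ℂ 2 (volume : Measure E)) :
    besselMul s (besselMul t G) = besselMul (s + t) G := by
  apply Lp.ext
  filter_upwards [coeFn_besselMul hs (besselMul t G), coeFn_besselMul ht G,
    coeFn_besselMul (add_nonneg hs ht) G] with ξ h1 h2 h3
  rw [h1, h2, h3, ← mul_assoc, ← Complex.ofReal_mul, jap_mul]
  ring_nf

lemma inner_eq_integral (X G : Lp ℂ 2 (volume : Measure E)) :
    inner ℂ X G = ∫ ξ, conj (X ξ) * G ξ := by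
  rw [L2.inner_def]
  simp_rw [RCLike.inner_apply, mul_comm]

lemma inner_besselMul {t : ℝ} (ht : 0 ≤ t) (X G : Lp ℂ 2 (volume : Measure E)) :
    inner ℂ (besselMul t X) G = inner ℂ X (besselMul t G) := by
  rw [inner_eq_integral, inner_eq_integral]
  apply integral_congr_ae
  filter_upwards [coeFn_besselMul ht X, coeFn_besselMul ht G] with ξ h1 h2
  rw [h1, h2, map_mul, Complex.conj_ofReal]
  ring

/-- The operator `(1 + |D|²)^{-t/2}` composed with the inverse Fourier transform on `L²`. -/
noncomputable def besselInv (t : ℝ) :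
    Lp ℂ 2 (volume : Measure E) →L[ℂ] Lp ℂ 2 (volume : Measure E) :=
  ((Lp.fourierTransformₗᵢ E ℂ).symm.toContinuousLinearEquiv : _ →L[ℂ] _) ∘L besselMul t

lemma besselInv_apply (t : ℝ) (G : Lp ℂ 2 (volume : Measure E)) :
    besselInv t G = 𝓕⁻ (besselMul t G) := rfl

lemma besselInv_besselMul {s t : ℝ} (hs : 0 ≤ s) (ht : 0 ≤ t) (G : Lp ℂ 2 (volume : Measure E)) :
    besselInv s (besselMul t G) = besselInv (s + t) G := by
  rw [besselInv_apply, besselInv_apply, besselMul_besselMul hs ht]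

lemma memLp_besselInv {t : ℝ} (ht : 0 < t) (htd : 2 * t < Module.finrank ℝ E)
    (G : Lp ℂ 2 (volume : Measure E)) :
    MemLp (besselInv t G) (sobolevExponent (Module.finrank ℝ E) t) volume := by
  obtain ⟨C, _, hC⟩ := exists_eLpNorm_fourierInv_besselMul_le (E := E) ht htd
  exact ⟨Lp.aestronglyMeasurable _, (hC G).trans_lt ENNReal.ofReal_lt_top⟩

lemma MeasureTheory.MemLp.conj {α : Type*} [MeasurableSpace α] {μ : Measure α} {f : α → ℂ}
    {p : ℝ≥0∞} (hf : MemLp f p μ) : MemLp (fun x => conj (f x)) p μ := hf.star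

/-- The operator representing the sesquilinear form of a potential in the critical Lebesgue space,
with norm controlled by the potential. -/
theorem exists_potential_operator {c t : ℝ} (ht : 0 < t) (htd : 2 * t < Module.finrank ℝ E)
    (hct : 0 < c - t) (hctd : 2 * (c - t) < Module.finrank ℝ E) :
    ∃ C : ℝ, 0 ≤ C ∧ ∀ W : E → ℂ, MemLp W (ENNReal.ofReal (Module.finrank ℝ E / c)) →
      ∃ P : Lp ℂ 2 (volume : Measure E) →L[ℂ] Lp ℂ 2 (volume : Measure E),
        ‖P‖ ≤ C * (eLpNorm W (ENNReal.ofReal (Module.finrank ℝ E / c)) volume).toReal ∧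
        ∀ X G, inner ℂ (P X) G = ∫ x, W x * besselInv t G x * conj (besselInv (c - t) X x) := by
  have hd : (0 : ℝ) < Module.finrank ℝ E := by linarith
  have hc : 0 < c := by linarith
  obtain ⟨C₁, hC₁, h₁⟩ := exists_eLpNorm_fourierInv_besselMul_le (E := E) ht htd
  obtain ⟨C₂, hC₂, h₂⟩ := exists_eLpNorm_fourierInv_besselMul_le (E := E) hct hctd
  refine ⟨C₁ * C₂, by positivity, fun W hW => ?_⟩
  have hint : ∀ X G : Lp ℂ 2 (volume : Measure E),
      Integrable fun x => W x * besselInv t G x * conj (besselInv (c - t) X x) := fun X G =>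
    integrable_potential_pairing hd hc htd hctd hW (memLp_besselInv ht htd G)
      (memLp_besselInv hct hctd X).conj
  -- Riesz representation makes the operator act on the antilinear variable `X`; its adjoint is
  -- `⟨D⟩^{t-c} W ⟨D⟩^{-t}` on the Fourier side.
  let b : Lp ℂ 2 (volume : Measure E) →ₗ⋆[ℂ] Lp ℂ 2 (volume : Measure E) →ₗ[ℂ] ℂ :=
    LinearMap.mk₂'ₛₗ (starRingEnd ℂ) (RingHom.id ℂ)
      (fun X G => ∫ x, W x * besselInv t G x * conj (besselInv (c - t) X x))
      (fun X X' G => by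
        rw [← integral_add (hint X G) (hint X' G), map_add]
        apply integral_congr_ae
        filter_upwards [Lp.coeFn_add (besselInv (c - t) X) (besselInv (c - t) X')] with x hx
        rw [hx, Pi.add_apply, map_add]; ring)
      (fun a X G => by
        rw [smul_eq_mul, ← integral_const_mul, map_smul]
        apply integral_congr_ae
        filter_upwards [Lp.coeFn_smul a (besselInv (c - t) X)] with x hx
        rw [hx, Pi.smul_apply, smul_eq_mul, map_mul]; ring)
      (fun X G G' => by
        rw [← integral_add (hint X G) (hint X G'), map_add]
        apply integral_congr_ae
        filter_upwards [Lp.coeFn_add (besselInv t G) (besselInv t G')] with x hx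
        rw [hx, Pi.add_apply]; ring)
      (fun a X G => by
        rw [RingHom.id_apply, smul_eq_mul, ← integral_const_mul, map_smul]
        apply integral_congr_ae
        filter_upwards [Lp.coeFn_smul a (besselInv t G)] with x hx
        rw [hx, Pi.smul_apply, smul_eq_mul]; ring)
  set w := (eLpNorm W (ENNReal.ofReal (Module.finrank ℝ E / c)) volume).toReal with hw
  have hw0 : 0 ≤ w := ENNReal.toReal_nonneg
  have hb : ∀ X G, ‖b X G‖ ≤ (C₁ * C₂ * w) * ‖X‖ * ‖G‖ := fun X G => by
    have h := norm_integral_potential_le hd hc htd hctd hW (memLp_besselInv ht htd G)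
      (memLp_besselInv hct hctd X).conj
    have e : eLpNorm (fun x => conj (besselInv (c - t) X x))
        (sobolevExponent (Module.finrank ℝ E) (c - t)) volume =
        eLpNorm (besselInv (c - t) X) (sobolevExponent (Module.finrank ℝ E) (c - t)) volume :=
      eLpNorm_congr_norm_ae (.of_forall fun x => RCLike.norm_conj _)
    rw [e] at h
    have h' : ‖b X G‖ₑ ≤ ENNReal.ofReal w * ENNReal.ofReal (C₁ * ‖G‖) *
        ENNReal.ofReal (C₂ * ‖X‖) := by
      refine h.trans ?_
      rw [hw, ENNReal.ofReal_toReal hW.2.ne]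
      gcongr
      · exact h₁ G
      · exact h₂ X
    rw [← ENNReal.ofReal_mul (by positivity), ← ENNReal.ofReal_mul (by positivity),
      ← ofReal_norm, ENNReal.ofReal_le_ofReal_iff (by positivity)] at h'
    linarith
  let B := LinearMap.mkContinuous₂ b (C₁ * C₂ * w) hb
  refine ⟨InnerProductSpace.continuousLinearMapOfBilin B, ?_, fun X G => ?_⟩
  · refine ContinuousLinearMap.opNorm_le_bound _ (by positivity) fun X => ?_
    have : ‖InnerProductSpace.continuousLinearMapOfBilin B X‖ = ‖B X‖ :=
      (InnerProductSpace.toDual ℂ (Lp ℂ 2 (volume : Measure E))).symm.norm_map (B X)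
    rw [this]
    refine ContinuousLinearMap.opNorm_le_bound _ (by positivity) fun G => hb X G
  · rw [InnerProductSpace.continuousLinearMapOfBilin_apply]; rfl

end Operators

/-! ### Cutoffs and commutators in frequency -/

section Localization

variable {E : Type*} [NormedAddCommGroup E] [InnerProductSpace ℝ E] [FiniteDimensional ℝ E]
  [MeasurableSpace E] [BorelSpace E]

/-- The product of two Schwartz functions. -/
noncomputable def schwartzMul (φ ψ : 𝓢(E, ℂ)) : 𝓢(E, ℂ) :=
  SchwartzMap.pairing (ContinuousLinearMap.mul ℂ ℂ) φ ψ

lemma schwartzMul_apply (φ ψ : 𝓢(E, ℂ)) (x : E) : schwartzMul φ ψ x = φ x * ψ x := rfl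

lemma fourierInv_schwartzMul (φ ψ : 𝓢(E, ℂ)) (η : E) :
    𝓕⁻ (schwartzMul φ ψ) η = ∫ ξ, 𝓕⁻ φ ξ * 𝓕⁻ ψ (η - ξ) := by
  have h := SchwartzMap.convolution_apply (ContinuousLinearMap.mul ℂ ℂ) (𝓕⁻ φ) (𝓕⁻ ψ) η
  have e : SchwartzMap.convolution (ContinuousLinearMap.mul ℂ ℂ) (𝓕⁻ φ) (𝓕⁻ ψ) =
      𝓕⁻ (schwartzMul φ ψ) := by
    simp [SchwartzMap.convolution, schwartzMul]
  rw [← e, h]; rfl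

lemma integral_mul_fourierInv (φ : 𝓢(E, ℂ)) (F : Lp ℂ 2 (volume : Measure E)) :
    ∫ x, φ x * (𝓕⁻ F : Lp ℂ 2 (volume : Measure E)) x = ∫ ξ, 𝓕⁻ φ ξ * F ξ := by
  have e1 := congrArg (fun T : 𝓢'(E, ℂ) => T φ) (Lp.fourierInv_toTemperedDistribution_eq F)
  simpa using e1.symm

lemma integrable_jap_mul_norm (C M : ℝ) (k : 𝓢(E, ℂ)) :
    Integrable fun ζ => C * jap M ζ * ‖k ζ‖ := by
  have h := (SchwartzMap.smulLeftCLM ℂ (fun ξ : E => (jap M ξ : ℂ)) k).integrable (μ := volume)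
  refine (h.norm.const_mul C).congr (.of_forall fun ζ => ?_)
  simp only
  rw [SchwartzMap.smulLeftCLM_apply_apply (hasTemperateGrowth_jap M), norm_smul, Complex.norm_real,
    Real.norm_of_nonneg (jap_pos _ _).le, mul_assoc]

lemma measurable_jap_mul_norm (C M : ℝ) (k : 𝓢(E, ℂ)) :
    Measurable fun ζ => C * jap M ζ * ‖k ζ‖ :=
  (((continuous_jap M).measurable.const_mul C).mul k.continuous.norm.measurable)

/-- The kernel of multiplication by a function with Fourier transform `k`, on weighted spaces. -/
noncomputable def mulKernel (s : ℝ) (k : 𝓢(E, ℂ)) (ξ η : E) : ℂ :=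
  (jap s ξ * jap (-s) η : ℝ) * k (η - ξ)

/-- The kernel of the commutator of `|D|^c` and a multiplication operator, on weighted spaces. -/
noncomputable def commKernel (s c ε : ℝ) (k : 𝓢(E, ℂ)) (ξ η : E) : ℂ :=
  (jap (s - c + ε) ξ * jap (-s) η * (jap c ξ - ‖η‖ ^ c) : ℝ) * k (η - ξ)

lemma continuous_mulKernel (s : ℝ) (k : 𝓢(E, ℂ)) :
    Continuous (Function.uncurry (mulKernel s k)) := by
  have h1 := continuous_jap (E := E) s
  have h2 := continuous_jap (E := E) (-s)
  have h3 := k.continuous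
  unfold mulKernel Function.uncurry
  fun_prop

lemma continuous_commKernel (s : ℝ) {c : ℝ} (hc : 0 < c) (ε : ℝ) (k : 𝓢(E, ℂ)) :
    Continuous (Function.uncurry (commKernel s c ε k)) := by
  have h1 := continuous_jap (E := E) (s - c + ε)
  have h2 := continuous_jap (E := E) (-s)
  have h4 := continuous_jap (E := E) c
  have h3 := k.continuous
  have h5 : Continuous fun η : E => ‖η‖ ^ c := continuous_norm.rpow_const fun _ => Or.inr hc.le
  have h6 : Continuous fun p : E × E => ‖p.2‖ ^ c := h5.comp continuous_snd
  unfold commKernel Function.uncurry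
  fun_prop

lemma norm_mulKernel_le {s : ℝ} (hs : 0 ≤ s) (k : 𝓢(E, ℂ)) (ξ η : E) :
    ‖mulKernel s k ξ η‖ ≤ 3 ^ s * jap s (η - ξ) * ‖k (η - ξ)‖ := by
  rw [mulKernel, norm_mul, Complex.norm_real, Real.norm_of_nonneg
    (mul_pos (jap_pos _ _) (jap_pos _ _)).le]
  exact mul_le_mul_of_nonneg_right (jap_mul_jap_neg_le hs ξ η) (norm_nonneg _)

lemma norm_commKernel_le {s c ε : ℝ} (hs : 0 ≤ s) (hc : 0 < c) (hε : ε ≤ 1) (k : 𝓢(E, ℂ)) (ξ η : E) :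
    ‖commKernel s c ε k ξ η‖ ≤
      (max 1 c * 3 ^ (c + 1) * 3 ^ s) * jap (c + 1 + s) (η - ξ) * ‖k (η - ξ)‖ := by
  rw [commKernel, norm_mul, Complex.norm_real, Real.norm_eq_abs, abs_mul,
    abs_of_pos (mul_pos (jap_pos _ _) (jap_pos _ _))]
  exact mul_le_mul_of_nonneg_right (commutator_symbol_le hs hc hε ξ η) (norm_nonneg _)

lemma memLp_schwartz_jap (t : ℝ) (Y : 𝓢(E, ℂ)) : MemLp (fun ξ => (jap t ξ : ℂ) * Y ξ) 2 := by
  refine ((SchwartzMap.smulLeftCLM ℂ (fun ξ : E => (jap t ξ : ℂ)) Y).memLp 2 volume).ae_eq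
    (.of_forall fun ζ => ?_)
  rw [SchwartzMap.smulLeftCLM_apply_apply (hasTemperateGrowth_jap t), smul_eq_mul]

/-- Multiplication by a Schwartz function preserves `H^s`. -/
lemma exists_besselInv_eq_mul {s : ℝ} (hs : 0 ≤ s) (ψ : 𝓢(E, ℂ)) (G : Lp ℂ 2 (volume : Measure E)) :
    ∃ A : Lp ℂ 2 (volume : Measure E),
      (A =ᵐ[volume] fun ξ => ∫ η, mulKernel s (𝓕⁻ ψ) ξ η * G η) ∧
      besselInv s A =ᵐ[volume] fun x => ψ x * besselInv s G x := by
  have hκ := integrable_jap_mul_norm (3 ^ s) s (𝓕⁻ ψ)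
  have hκm := measurable_jap_mul_norm (3 ^ s) s (𝓕⁻ ψ)
  have hK := continuous_mulKernel s (𝓕⁻ ψ)
  have hb := norm_mulKernel_le hs (𝓕⁻ ψ)
  have hA := memLp_integral_kernel hκ hκm hK hb (Lp.memLp G)
  refine ⟨hA.toLp, hA.coeFn_toLp, ?_⟩
  have hψ : MemLp (fun x => ψ x * besselInv s G x) 2 :=
    (Lp.memLp (besselInv s G)).mul (ψ.memLp ∞ volume)
  -- In frequency, the weight `⟨ξ⟩ ^ s` of the kernel cancels that of `besselInv s`, leaving the
  -- convolution that represents multiplication by `ψ`.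
  refine ae_eq_of_integral_contDiff_smul_eq ((Lp.memLp _).locallyIntegrable (by norm_num))
    (hψ.locallyIntegrable (by norm_num)) fun g hg hgc => ?_
  have hg₁ : HasCompactSupport (Complex.ofRealCLM ∘ g) := hgc.comp_left rfl
  have hg₂ : ContDiff ℝ (↑(⊤ : ℕ∞)) (Complex.ofRealCLM ∘ g) := by fun_prop
  set φ : 𝓢(E, ℂ) := hg₁.toSchwartzMap hg₂ with hφ
  calc ∫ x, g x • besselInv s hA.toLp x
      = ∫ x, φ x * besselInv s hA.toLp x := rfl
    _ = ∫ ξ, 𝓕⁻ φ ξ * besselMul s hA.toLp ξ := by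
        rw [besselInv_apply, integral_mul_fourierInv]
    _ = ∫ ξ, ((jap (-s) ξ : ℂ) * 𝓕⁻ φ ξ) * ∫ η, mulKernel s (𝓕⁻ ψ) ξ η * G η := by
        apply integral_congr_ae
        filter_upwards [coeFn_besselMul hs hA.toLp, hA.coeFn_toLp] with ξ h1 h2
        rw [h1, h2]; ring
    _ = ∫ η, (∫ ξ, ((jap (-s) ξ : ℂ) * 𝓕⁻ φ ξ) * mulKernel s (𝓕⁻ ψ) ξ η) * G η :=
        integral_kernel_pairing_swap hκ hκm hK hb (memLp_schwartz_jap _ _) (Lp.memLp G)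
    _ = ∫ η, 𝓕⁻ (schwartzMul φ ψ) η * besselMul s G η := by
        apply integral_congr_ae
        filter_upwards [coeFn_besselMul hs G] with η h1
        rw [h1, fourierInv_schwartzMul, ← mul_assoc]
        congr 1
        rw [← integral_mul_const]
        refine integral_congr_ae (.of_forall fun ξ => ?_)
        simp only
        have : (jap (-s) ξ : ℂ) * jap s ξ = 1 := by
          rw [← Complex.ofReal_mul, jap_mul]; simp
        rw [mulKernel]
        push_cast
        linear_combination (𝓕⁻ φ ξ * jap (-s) η * 𝓕⁻ ψ (η - ξ)) * this
    _ = ∫ x, schwartzMul φ ψ x * besselInv s G x := by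
        rw [besselInv_apply, integral_mul_fourierInv]
    _ = ∫ x, g x • (ψ x * besselInv s G x) := by
        congr 1; ext x
        rw [schwartzMul_apply, mul_assoc]; rfl

/-- The commutator of `|D|^c` with a multiplication operator, tested against a Schwartz function. -/
lemma exists_commutator_eq {s c ε : ℝ} (hs : 0 ≤ s) (hc : 0 < c) (hε : ε ≤ 1) (ψ : 𝓢(E, ℂ))
    (G A : Lp ℂ 2 (volume : Measure E))
    (hA : A =ᵐ[volume] fun ξ => ∫ η, mulKernel s (𝓕⁻ ψ) ξ η * G η) :
    ∃ B : Lp ℂ 2 (volume : Measure E), ∀ Y : 𝓢(E, ℂ),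
      (∫ ξ, ((jap (c - s) ξ : ℂ) * Y ξ) * A ξ) -
        ∫ η, 𝓕⁻ (schwartzMul (𝓕 Y) ψ) η * ((‖η‖ ^ c * jap (-s) η : ℝ) * G η) =
      ∫ ξ, ((jap (c - s - ε) ξ : ℂ) * Y ξ) * B ξ := by
  have hκ := integrable_jap_mul_norm (3 ^ s) s (𝓕⁻ ψ)
  have hκm := measurable_jap_mul_norm (3 ^ s) s (𝓕⁻ ψ)
  have hK := continuous_mulKernel s (𝓕⁻ ψ)
  have hb := norm_mulKernel_le hs (𝓕⁻ ψ)
  have hκ' := integrable_jap_mul_norm (max 1 c * 3 ^ (c + 1) * 3 ^ s) (c + 1 + s) (𝓕⁻ ψ)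
  have hκm' := measurable_jap_mul_norm (max 1 c * 3 ^ (c + 1) * 3 ^ s) (c + 1 + s) (𝓕⁻ ψ)
  have hK' := continuous_commKernel s hc ε (𝓕⁻ ψ)
  have hb' := norm_commKernel_le hs hc hε (𝓕⁻ ψ)
  have hB := memLp_integral_kernel hκ' hκm' hK' hb' (Lp.memLp G)
  obtain ⟨B, hB⟩ : ∃ B : Lp ℂ 2 (volume : Measure E),
    B =ᵐ[volume] fun ξ => ∫ η, commKernel s c ε (𝓕⁻ ψ) ξ η * G η := ⟨hB.toLp, hB.coeFn_toLp⟩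
  refine ⟨B, fun Y => ?_⟩
  have hY := memLp_schwartz_jap (c - s) Y
  have hY' := memLp_schwartz_jap (c - s - ε) Y
  have e1 : ∫ ξ, ((jap (c - s) ξ : ℂ) * Y ξ) * A ξ =
      ∫ η, (∫ ξ, ((jap (c - s) ξ : ℂ) * Y ξ) * mulKernel s (𝓕⁻ ψ) ξ η) * G η := by
    rw [← integral_kernel_pairing_swap hκ hκm hK hb hY (Lp.memLp G)]
    apply integral_congr_ae
    filter_upwards [hA] with ξ h
    rw [h]
  have e2 : ∫ ξ, ((jap (c - s - ε) ξ : ℂ) * Y ξ) * B ξ =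
      ∫ η, (∫ ξ, ((jap (c - s - ε) ξ : ℂ) * Y ξ) * commKernel s c ε (𝓕⁻ ψ) ξ η) * G η := by
    rw [← integral_kernel_pairing_swap hκ' hκm' hK' hb' hY' (Lp.memLp G)]
    apply integral_congr_ae
    filter_upwards [hB] with ξ h
    rw [h]
  have i1 := integrable_integral_kernel_mul hκ hκm hK hb hY (Lp.memLp G)
  have i2 := integrable_integral_kernel_mul hκ' hκm' hK' hb' hY' (Lp.memLp G)
  rw [e1, e2, sub_eq_iff_eq_add, add_comm, ← sub_eq_iff_eq_add, ← integral_sub i1 i2]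
  congr 1
  ext η
  rw [fourierInv_schwartzMul, FourierTransform.fourierInv_fourier_eq, ← sub_mul, ← mul_assoc]
  congr 1
  have hYk : ∀ t : ℝ, Integrable fun ξ => (jap t ξ : ℂ) * Y ξ * 𝓕⁻ ψ (η - ξ) := fun t => by
    have h1 := ((SchwartzMap.smulLeftCLM ℂ (fun ξ : E => (jap t ξ : ℂ)) Y)).integrable
      (μ := volume)
    refine (h1.mul_bdd (c := SchwartzMap.seminorm ℝ 0 0 (𝓕⁻ ψ)) (g := fun ξ => 𝓕⁻ ψ (η - ξ)) ?_
      (.of_forall fun ξ => SchwartzMap.norm_le_seminorm ℝ _ _)).congr (.of_forall fun ζ => ?_)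
    · exact ((𝓕⁻ ψ).continuous.comp (continuous_const.sub continuous_id)).aestronglyMeasurable
    · simp only
      rw [SchwartzMap.smulLeftCLM_apply_apply (hasTemperateGrowth_jap t), smul_eq_mul]
  -- The two weighted kernels carry the symbols `⟨ξ⟩ ^ c` and `⟨ξ⟩ ^ c - ‖η‖ ^ c`. Their difference
  -- leaves `‖η‖ ^ c`, the term `ψ |D|^c u`.
  have f1 : ∀ ξ, ((jap (c - s) ξ : ℂ) * Y ξ) * mulKernel s (𝓕⁻ ψ) ξ η =
      (jap (-s) η : ℂ) * ((jap c ξ : ℂ) * Y ξ * 𝓕⁻ ψ (η - ξ)) := fun ξ => by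
    have : (jap (c - s) ξ : ℂ) * jap s ξ = jap c ξ := by
      rw [← Complex.ofReal_mul, jap_mul]; simp
    rw [mulKernel]; push_cast
    linear_combination (Y ξ * jap (-s) η * 𝓕⁻ ψ (η - ξ)) * this
  have f2 : ∀ ξ, ((jap (c - s - ε) ξ : ℂ) * Y ξ) * commKernel s c ε (𝓕⁻ ψ) ξ η =
      (jap (-s) η : ℂ) * ((jap c ξ : ℂ) * Y ξ * 𝓕⁻ ψ (η - ξ)) -
        (jap (-s) η : ℂ) * (‖η‖ ^ c : ℝ) * ((jap 0 ξ : ℂ) * Y ξ * 𝓕⁻ ψ (η - ξ)) := fun ξ => by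
    have : (jap (c - s - ε) ξ : ℂ) * jap (s - c + ε) ξ = 1 := by
      rw [← Complex.ofReal_mul, jap_mul]; ring_nf; simp
    rw [commKernel, jap_zero]; push_cast
    linear_combination (Y ξ * jap (-s) η * 𝓕⁻ ψ (η - ξ) * (jap c ξ - (‖η‖ ^ c : ℝ))) * this
  simp_rw [f1, f2]
  rw [integral_sub ((hYk c).const_mul _) ((hYk 0).const_mul _), sub_sub_cancel, integral_const_mul]
  simp_rw [jap_zero]
  push_cast
  simp_rw [one_mul]
  ring

end Localization

/-! ### The regularity gain for the model equation -/

section Regularity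

variable {E : Type*} [NormedAddCommGroup E] [InnerProductSpace ℝ E] [FiniteDimensional ℝ E]
  [MeasurableSpace E] [BorelSpace E]

/-- The complex conjugate of a Schwartz function. -/
noncomputable def schwartzConj (Z : 𝓢(E, ℂ)) : 𝓢(E, ℂ) :=
  SchwartzMap.postcompCLM (𝕜 := ℝ) (Complex.conjCLE : ℂ →L[ℝ] ℂ) Z

lemma schwartzConj_apply (Z : 𝓢(E, ℂ)) (x : E) : schwartzConj Z x = conj (Z x) := rfl

lemma fourier_schwartzConj (Z : 𝓢(E, ℂ)) (x : E) : 𝓕 (schwartzConj Z) x = conj (𝓕⁻ Z x) := by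
  rw [SchwartzMap.fourier_coe, SchwartzMap.fourierInv_coe, Real.fourier_eq, Real.fourierInv_eq,
    ← integral_conj]
  congr 1
  ext v
  rw [schwartzConj_apply, Circle.smul_def, Circle.smul_def, smul_eq_mul, smul_eq_mul, map_mul,
    AddChar.map_neg_eq_inv, Circle.coe_inv_eq_conj]

lemma besselInv_toLp {t : ℝ} (ht : 0 ≤ t) (X : 𝓢(E, ℂ)) :
    besselInv t (X.toLp 2) =ᵐ[volume]
      (𝓕⁻ (SchwartzMap.smulLeftCLM ℂ (fun ξ : E => (jap (-t) ξ : ℂ)) X) : 𝓢(E, ℂ)) := by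
  set Z := SchwartzMap.smulLeftCLM ℂ (fun ξ : E => (jap (-t) ξ : ℂ)) X with hZ
  have e : besselMul t (X.toLp 2) = Z.toLp 2 := by
    apply Lp.ext
    filter_upwards [coeFn_besselMul ht (X.toLp 2), X.coeFn_toLp 2 volume, Z.coeFn_toLp 2 volume]
      with ξ h1 h2 h3
    rw [h1, h2, h3, hZ, SchwartzMap.smulLeftCLM_apply_apply (hasTemperateGrowth_jap _), smul_eq_mul]
  rw [besselInv_apply, e, SchwartzMap.toLp_fourierInv_eq]
  exact SchwartzMap.coeFn_toLp _ _ _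

/-- A function in a Lebesgue space is the sum of a small function in this space and a bounded one. -/
lemma exists_small_add_bounded {p : ℝ≥0∞} {U : E → ℂ} (hU : MemLp U p) {δ : ℝ} (hδ : 0 < δ) :
    ∃ W V : E → ℂ, U =ᵐ[volume] W + V ∧ MemLp W p ∧ eLpNorm W p volume ≤ ENNReal.ofReal δ ∧
      MemLp V ∞ := by
  set U' := hU.1.mk with hU'
  have hm : StronglyMeasurable U' := hU.1.stronglyMeasurable_mk
  have hae : U =ᵐ[volume] U' := hU.1.ae_eq_mk
  have hmem : MemLp U' p := hU.ae_eq hae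
  obtain ⟨M, hM⟩ := hmem.eLpNorm_indicator_norm_ge_le hm hδ
  have hS : MeasurableSet {x | M ≤ ‖U' x‖₊} := by
    simp only [coe_nnnorm]
    exact measurableSet_le measurable_const hm.measurable.norm
  refine ⟨_, {x | M ≤ ‖U' x‖₊}ᶜ.indicator U', ?_, hmem.indicator hS, hM, ?_⟩
  · rw [Set.indicator_self_add_compl]; exact hae
  · refine memLp_top_of_bound (hm.indicator hS.compl).aestronglyMeasurable |M|
      (.of_forall fun x => ?_)
    by_cases h : x ∈ {x | M ≤ ‖U' x‖₊}
    · rw [Set.indicator_of_notMem (show x ∉ {x | M ≤ ‖U' x‖₊}ᶜ from fun h' => h' h), norm_zero]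
      exact abs_nonneg M
    · rw [Set.indicator_of_mem (show x ∈ {x | M ≤ ‖U' x‖₊}ᶜ from h)]
      have h' : ‖U' x‖ < M := not_le.mp h
      exact h'.le.trans (le_abs_self _)

/-- The weak form of `(1 + P)† A = J B`. The witness `B` is the commutator term minus the
contribution of the bounded part `V` of the potential, which needs only `ψu ∈ L²`. -/
lemma exists_equation {s c ε : ℝ} (hs : 0 < s) (hε0 : 0 < ε) (hε1 : ε ≤ 1) (hsc : s + ε < c)
    (hsd : 2 * s < Module.finrank ℝ E) (hcs : 2 * (c - s) < Module.finrank ℝ E) {U W V : E → ℂ}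
    (hUWV : U =ᵐ[volume] W + V) (hW : MemLp W (ENNReal.ofReal (Module.finrank ℝ E / c)))
    (hV : MemLp V ∞) (ψ : 𝓢(E, ℂ)) (G A : Lp ℂ 2 (volume : Measure E))
    (hA : A =ᵐ[volume] fun ξ => ∫ η, mulKernel s (𝓕⁻ ψ) ξ η * G η)
    (hAψ : besselInv s A =ᵐ[volume] fun x => ψ x * besselInv s G x)
    (heq : ∀ Y : 𝓢(E, ℂ),
      (∫ η, 𝓕⁻ (schwartzMul (𝓕 Y) ψ) η * ((‖η‖ ^ c * jap (-s) η : ℝ) * G η)) +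
        ∫ x, 𝓕 Y x * (U x * (ψ x * besselInv s G x)) = 0) :
    ∃ B : Lp ℂ 2 (volume : Measure E), ∀ X : 𝓢(E, ℂ), inner ℂ (X.toLp 2) A +
      ∫ x, W x * besselInv s A x * conj (besselInv (c - s) (X.toLp 2) x) =
        inner ℂ (besselMul ε (X.toLp 2)) B := by
  have hd : (0 : ℝ) < Module.finrank ℝ E := by linarith
  obtain ⟨B, hB⟩ := exists_commutator_eq hs.le (by linarith : 0 < c) hε1 ψ G A hA
  have hh : MemLp (fun x => V x * besselInv s A x) 2 := (Lp.memLp (besselInv s A)).mul hV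
  refine ⟨B - besselMul (c - s - ε) (𝓕 hh.toLp), fun X => ?_⟩
  -- Testing with the conjugate of `⟨ξ⟩ ^ (s - c) X` turns the leading bilinear pairing into `inner
  -- ℂ X A` and the physical test function into the conjugate of `besselInv (c - s) X`.
  set Z := SchwartzMap.smulLeftCLM ℂ (fun ξ : E => (jap (s - c) ξ : ℂ)) X with hZ
  have hZa : ∀ ξ, Z ξ = (jap (s - c) ξ : ℂ) * X ξ := fun ξ => by
    rw [hZ, SchwartzMap.smulLeftCLM_apply_apply (hasTemperateGrowth_jap _), smul_eq_mul]
  set x2 : Lp ℂ 2 (volume : Measure E) := X.toLp 2 with hx2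
  have hx2c := X.coeFn_toLp 2 volume
  have hY : ∀ᵐ x, 𝓕 (schwartzConj Z) x = conj (besselInv (c - s) x2 x) := by
    have := besselInv_toLp (E := E) (t := c - s) (by linarith) X
    rw [neg_sub] at this
    filter_upwards [this] with x hx
    rw [fourier_schwartzConj, hx]
  have hBY := hB (schwartzConj Z)
  have e1 : ∫ ξ, ((jap (c - s) ξ : ℂ) * schwartzConj Z ξ) * A ξ = inner ℂ x2 A := by
    rw [inner_eq_integral]
    apply integral_congr_ae
    filter_upwards [hx2c] with ξ h1
    rw [h1, schwartzConj_apply, hZa, map_mul, Complex.conj_ofReal, ← mul_assoc,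
      ← Complex.ofReal_mul, jap_mul]
    simp
  have e2 : ∫ ξ, ((jap (c - s - ε) ξ : ℂ) * schwartzConj Z ξ) * B ξ =
      inner ℂ (besselMul ε x2) B := by
    rw [inner_eq_integral]
    apply integral_congr_ae
    filter_upwards [hx2c, coeFn_besselMul hε0.le x2] with ξ h1 h2
    rw [h2, h1, schwartzConj_apply, hZa, map_mul, Complex.conj_ofReal, ← mul_assoc,
      ← Complex.ofReal_mul, jap_mul, map_mul, Complex.conj_ofReal]
    ring_nf
  have e3 : ∫ x, 𝓕 (schwartzConj Z) x * (U x * (ψ x * besselInv s G x)) =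
      (∫ x, W x * besselInv s A x * conj (besselInv (c - s) x2 x)) +
        inner ℂ (besselInv (c - s) x2) hh.toLp := by
    rw [inner_eq_integral, ← integral_add]
    · apply integral_congr_ae
      filter_upwards [hY, hUWV, hAψ, hh.coeFn_toLp] with x h1 h2 h3 h4
      rw [h1, h2, ← h3, h4, Pi.add_apply]
      ring
    · exact integrable_potential_pairing hd (by linarith) hsd hcs hW (memLp_besselInv hs hsd A)
        (memLp_besselInv (by linarith) hcs x2).conj
    · exact (Lp.memLp (besselInv (c - s) x2)).conj.integrable_mul (Lp.memLp hh.toLp)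
  -- Of the smoothing order `c - s` on the test function, `ε` stays there as `J` and the rest,
  -- nonnegative by `hsc`, passes to the `L²` term.
  have e4 : inner ℂ (besselInv (c - s) x2) hh.toLp =
      inner ℂ (besselMul ε x2) (besselMul (c - s - ε) (𝓕 hh.toLp)) := by
    have : besselInv (c - s) x2 = besselInv (c - s - ε) (besselMul ε x2) := by
      rw [besselInv_besselMul (by linarith) hε0.le]; ring_nf
    rw [this, ← inner_besselMul (by linarith), besselInv_apply, ← Lp.inner_fourier_eq,
      FourierTransform.fourier_fourierInv_eq]
  have hq := heq (schwartzConj Z)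
  rw [inner_sub_right, ← e4, ← e2, ← hBY, e1]
  rw [e3] at hq
  linear_combination hq

/-- Regularity of the solutions of `|D|^c u + U u = 0` with `U` in the critical Lebesgue space. -/
theorem exists_besselInv_eq_of_solution {s c ε : ℝ} (hs : 0 < s) (hε0 : 0 < ε) (hε1 : ε ≤ 1)
    (hsc : s + ε < c) (hsd : 2 * (s + ε) < Module.finrank ℝ E)
    (hcs : 2 * (c - s) < Module.finrank ℝ E) {U : E → ℂ}
    (hU : MemLp U (ENNReal.ofReal (Module.finrank ℝ E / c))) (ψ : 𝓢(E, ℂ))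
    (G : Lp ℂ 2 (volume : Measure E))
    (heq : ∀ Y : 𝓢(E, ℂ),
      (∫ η, 𝓕⁻ (schwartzMul (𝓕 Y) ψ) η * ((‖η‖ ^ c * jap (-s) η : ℝ) * G η)) +
        ∫ x, 𝓕 Y x * (U x * (ψ x * besselInv s G x)) = 0) :
    ∃ G' : Lp ℂ 2 (volume : Measure E),
      besselInv (s + ε) G' =ᵐ[volume] fun x => ψ x * besselInv s G x := by
  obtain ⟨A, hA, hAψ⟩ := exists_besselInv_eq_mul hs.le ψ G
  obtain ⟨C, hC, hop⟩ := exists_potential_operator (E := E) (c := c) hs (by linarith)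
    (by linarith : 0 < c - s) hcs
  obtain ⟨C', hC', hop'⟩ := exists_potential_operator (E := E) (c := c) (t := s + ε) (by linarith)
    hsd (by linarith) (by linarith)
  -- A single splitting of the potential must make both `P` and `P'` of norm less than `1`.
  have hδ : 0 < (C + C' + 1)⁻¹ := by positivity
  obtain ⟨W, V, hUWV, hW, hWδ, hV⟩ := exists_small_add_bounded hU hδ
  have hw : (eLpNorm W (ENNReal.ofReal (Module.finrank ℝ E / c)) volume).toReal ≤
      (C + C' + 1)⁻¹ := ENNReal.toReal_le_of_le_ofReal hδ.le hWδ
  have hsmall : ∀ a, 0 ≤ a → a ≤ C + C' →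
      a * (eLpNorm W (ENNReal.ofReal (Module.finrank ℝ E / c)) volume).toReal < 1 := by
    intro a ha ha'
    calc _ ≤ a * (C + C' + 1)⁻¹ := by gcongr
      _ < 1 := by rw [← div_eq_mul_inv, div_lt_one (by positivity)]; linarith
  obtain ⟨P, hP, hPi⟩ := hop W hW
  obtain ⟨P', hP', hPi'⟩ := hop' W hW
  obtain ⟨B, hB⟩ := exists_equation hs hε0 hε1 hsc (by linarith) hcs hUWV hW hV ψ G A hA hAψ heq
  have hdense : ∀ X : Lp ℂ 2 (volume : Measure E),
      inner ℂ X A + inner ℂ (P X) A = inner ℂ (besselMul ε X) B := by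
    intro X
    refine DenseRange.induction_on (p := fun X : Lp ℂ 2 (volume : Measure E) =>
      inner ℂ X A + inner ℂ (P X) A = inner ℂ (besselMul ε X) B)
      (SchwartzMap.denseRange_toLpCLM (E := E) (F := ℂ) (p := 2) (μ := volume)
        ENNReal.ofNat_ne_top) X ?_ fun Y => ?_
    · exact isClosed_eq (by fun_prop) (by fun_prop)
    · rw [SchwartzMap.toLpCLM_apply, hPi]
      exact hB Y
  -- Paired with `Q`, both sides are the form of `W` on `besselInv (s + ε) Q` and `besselInv (c - s)
  -- X`.
  have hcomm : ∀ X, besselMul ε (P X) = P' (besselMul ε X) := fun X => by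
    refine ext_inner_right ℂ fun Q => ?_
    rw [inner_besselMul hε0.le, hPi, hPi', besselInv_besselMul hs.le hε0.le,
      besselInv_besselMul (by linarith) hε0.le]
    ring_nf
  obtain ⟨G', hG'⟩ := exists_eq_of_intertwine (fun x y => inner_besselMul hε0.le x y)
    (hP.trans_lt (hsmall C hC (by linarith))) (hP'.trans_lt (hsmall C' hC' (by linarith)))
    hcomm hdense
  refine ⟨G', ?_⟩
  rw [← besselInv_besselMul hs.le hε0.le, ← hG']
  exact hAψ

end Regularity

/-! ### Sobolev spaces as ranges of Bessel potentials -/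

section Sobolev

variable {E : Type*} [NormedAddCommGroup E] [InnerProductSpace ℝ E] [FiniteDimensional ℝ E]
  [MeasurableSpace E] [BorelSpace E]

lemma toTemperedDistribution_besselInv_apply (t : ℝ) (G : Lp ℂ 2 (volume : Measure E))
    (φ : 𝓢(E, ℂ)) :
    (besselInv t G : 𝓢'(E, ℂ)) φ = ∫ ξ, 𝓕⁻ φ ξ * besselMul t G ξ := by
  rw [Lp.toTemperedDistribution_apply, ← integral_mul_fourierInv]
  rfl

/-- Elements of `H^s` with `s ≥ 0` are Bessel potentials of `L²` functions. -/
lemma exists_eq_besselInv {s : ℝ} (hs : 0 ≤ s) {w : 𝓢'(E, ℂ)}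
    (hw : TemperedDistribution.MemSobolev s 2 w) :
    ∃ G : Lp ℂ 2 (volume : Measure E), w = (besselInv s G : 𝓢'(E, ℂ)) := by
  obtain ⟨G, hG⟩ := TemperedDistribution.memSobolev_iff_exists_smulLeftCLM_fourier.mp hw
  refine ⟨G, ?_⟩
  ext φ
  rw [toTemperedDistribution_besselInv_apply]
  have h := congrArg (fun T : 𝓢'(E, ℂ) => T (SchwartzMap.smulLeftCLM ℂ
    (fun ξ : E => (jap (-s) ξ : ℂ)) (𝓕⁻ φ))) hG
  have e : SchwartzMap.smulLeftCLM ℂ (fun ξ : E => (jap s ξ : ℂ))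
      (SchwartzMap.smulLeftCLM ℂ (fun ξ : E => (jap (-s) ξ : ℂ)) (𝓕⁻ φ)) = 𝓕⁻ φ := by
    ext ξ
    rw [SchwartzMap.smulLeftCLM_apply_apply (hasTemperateGrowth_jap _),
      SchwartzMap.smulLeftCLM_apply_apply (hasTemperateGrowth_jap _), smul_smul,
      ← Complex.ofReal_mul, jap_mul]
    simp
  calc w φ = w (𝓕 (𝓕⁻ φ)) := by rw [FourierTransform.fourier_fourierInv_eq]
    _ = w (𝓕 (SchwartzMap.smulLeftCLM ℂ (fun ξ : E => (jap s ξ : ℂ))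
          (SchwartzMap.smulLeftCLM ℂ (fun ξ : E => (jap (-s) ξ : ℂ)) (𝓕⁻ φ)))) := by rw [e]
    _ = (G : 𝓢'(E, ℂ)) (SchwartzMap.smulLeftCLM ℂ (fun ξ : E => (jap (-s) ξ : ℂ)) (𝓕⁻ φ)) := h
    _ = ∫ ξ, 𝓕⁻ φ ξ * besselMul s G ξ := by
      rw [Lp.toTemperedDistribution_apply]
      apply integral_congr_ae
      filter_upwards [coeFn_besselMul hs G] with ξ h1
      rw [h1, SchwartzMap.smulLeftCLM_apply_apply (hasTemperateGrowth_jap _), smul_eq_mul,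
        smul_eq_mul]
      ring

lemma memSobolev_besselInv {t : ℝ} (ht : 0 ≤ t) (G : Lp ℂ 2 (volume : Measure E)) :
    TemperedDistribution.MemSobolev t 2 (besselInv t G : 𝓢'(E, ℂ)) := by
  refine TemperedDistribution.memSobolev_iff_exists_smulLeftCLM_fourier.mpr ⟨G, ?_⟩
  ext φ
  rw [TemperedDistribution.smulLeftCLM_apply_apply, TemperedDistribution.fourier_apply,
    toTemperedDistribution_besselInv_apply, FourierTransform.fourierInv_fourier_eq,
    Lp.toTemperedDistribution_apply]
  apply integral_congr_ae
  filter_upwards [coeFn_besselMul ht G] with ξ h1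
  have h2 : (SchwartzMap.smulLeftCLM ℂ (fun ξ : E => (jap t ξ : ℂ)) φ) ξ = jap t ξ * φ ξ := by
    rw [SchwartzMap.smulLeftCLM_apply_apply (hasTemperateGrowth_jap _), smul_eq_mul]
  have h3 : (jap t ξ : ℂ) * jap (-t) ξ = 1 := by
    rw [← Complex.ofReal_mul, jap_mul]; simp
  change (SchwartzMap.smulLeftCLM ℂ (fun ξ : E => (jap t ξ : ℂ)) φ) ξ * _ = _
  rw [h1, h2, smul_eq_mul]
  linear_combination (φ ξ * G ξ) * h3

end Sobolev

/-! ### Distributions given by functions -/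

section Distributions

variable {n : ℕ}

lemma testToSchwartz_apply {Ω : Opens (EuclideanSpace ℝ (Fin n))} (φ : 𝓓(Ω, ℝ))
    (x : EuclideanSpace ℝ (Fin n)) : testToSchwartz φ x = (φ x : ℂ) := rfl

lemma IsExtension.isGivenByOn {Ω : Opens (EuclideanSpace ℝ (Fin n))} {u : 𝓓'(Ω, ℂ)}
    {f : Lp ℂ 2 (volume : Measure (EuclideanSpace ℝ (Fin n)))}
    (h : IsExtension (f : 𝓢'(EuclideanSpace ℝ (Fin n), ℂ)) u) : IsGivenByOn u f := by
  refine ⟨((Lp.memLp f).locallyIntegrable (by norm_num)).locallyIntegrableOn _, fun φ => ?_⟩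
  rw [h φ, Lp.toTemperedDistribution_apply]
  rfl

lemma exists_isGivenByOn {Ω : Opens (EuclideanSpace ℝ (Fin n))}
    {f : EuclideanSpace ℝ (Fin n) → ℂ} (hf : LocallyIntegrableOn f Ω) :
    ∃ w : 𝓓'(Ω, ℂ), IsGivenByOn w f := by
  refine ⟨(TestFunction.integralAgainstBilinCLM (ContinuousLinearMap.lsmul ℝ ℝ) volume f :
    𝓓(Ω, ℝ) →L[ℝ] ℂ), hf, fun φ => ?_⟩
  refine (TestFunction.integralAgainstBilinCLM_eq_integral hf).trans ?_
  simp [Complex.real_smul]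

/-- The product `V u` is defined through some representative of `u`; uniqueness identifies it on `Ω`
with the Bessel potential extending `u`. -/
lemma IsGivenByOn.ae_eq {Ω : Opens (EuclideanSpace ℝ (Fin n))} {u : 𝓓'(Ω, ℂ)}
    {f g : EuclideanSpace ℝ (Fin n) → ℂ} (hf : IsGivenByOn u f) (hg : IsGivenByOn u g) :
    ∀ᵐ x, x ∈ Ω → f x = g x := by
  have h := Ω.isOpen.ae_eq_zero_of_integral_contDiff_smul_eq_zero (μ := volume)
    (hf.1.sub hg.1) fun k hk hkc hkΩ => ?_
  · filter_upwards [h] with x hx hxΩ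
    exact sub_eq_zero.mp (hx hxΩ)
  · let φ : 𝓓(Ω, ℝ) := ⟨k, hk, hkc, hkΩ⟩
    have e := (hf.2 φ).symm.trans (hg.2 φ)
    have i1 : Integrable fun x => (φ x : ℂ) * f x := by
      simpa [Complex.real_smul] using φ.integrable_bilin (ContinuousLinearMap.lsmul ℝ ℝ) hf.1
    have i2 : Integrable fun x => (φ x : ℂ) * g x := by
      simpa [Complex.real_smul] using φ.integrable_bilin (ContinuousLinearMap.lsmul ℝ ℝ) hg.1
    have : ∫ x, k x • (f - g) x = (∫ x, (φ x : ℂ) * f x) - ∫ x, (φ x : ℂ) * g x := by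
      rw [← integral_sub i1 i2]
      congr 1; ext x
      rw [Complex.real_smul, Pi.sub_apply, mul_sub]; rfl
    rw [this, e, sub_self]

lemma IsGivenBy.locallyIntegrable {T : 𝓢'(EuclideanSpace ℝ (Fin n), ℂ)}
    {g : EuclideanSpace ℝ (Fin n) → ℂ} (h : IsGivenBy T g) : LocallyIntegrable g := by
  intro x
  let b : ContDiffBump x := ⟨1, 2, one_pos, one_lt_two⟩
  have hc : HasCompactSupport fun y => (b y : ℂ) :=
    b.hasCompactSupport.comp_left (g := fun t : ℝ => (t : ℂ)) Complex.ofReal_zero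
  have hs : ContDiff ℝ ∞ fun y => (b y : ℂ) := Complex.ofRealCLM.contDiff.comp b.contDiff
  refine ⟨Metric.closedBall x 1, Metric.closedBall_mem_nhds x one_pos, ?_⟩
  refine ((h (hc.toSchwartzMap hs)).1.integrableOn (s := Metric.closedBall x 1)).congr_fun
    (fun y hy => ?_) measurableSet_closedBall
  change (b y : ℂ) * g y = g y
  rw [b.one_of_mem_closedBall hy]
  simp

/-- Likewise, `IsFracLaplacian` provides some density of the Fourier transform, identified by
uniqueness with `besselMul s G`. -/
lemma IsGivenBy.ae_eq {T : 𝓢'(EuclideanSpace ℝ (Fin n), ℂ)}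
    {f g : EuclideanSpace ℝ (Fin n) → ℂ} (hf : IsGivenBy T f) (hg : IsGivenBy T g) :
    f =ᵐ[volume] g := by
  refine ae_eq_of_integral_contDiff_smul_eq hf.locallyIntegrable hg.locallyIntegrable
    fun k hk hkc => ?_
  have hc : HasCompactSupport fun y => (k y : ℂ) :=
    hkc.comp_left (g := fun t : ℝ => (t : ℂ)) Complex.ofReal_zero
  have hs : ContDiff ℝ ∞ fun y => (k y : ℂ) := Complex.ofRealCLM.contDiff.comp hk
  exact (hf (hc.toSchwartzMap hs)).2.symm.trans (hg (hc.toSchwartzMap hs)).2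

lemma isGivenBy_fourier_besselInv (s : ℝ)
    (G : Lp ℂ 2 (volume : Measure (EuclideanSpace ℝ (Fin n)))) :
    IsGivenBy (𝓕 (besselInv s G : 𝓢'(EuclideanSpace ℝ (Fin n), ℂ))) (besselMul s G) := by
  intro φ
  refine ⟨(φ.memLp 2 volume).integrable_mul (Lp.memLp _), ?_⟩
  rw [TemperedDistribution.fourier_apply, toTemperedDistribution_besselInv_apply,
    FourierTransform.fourierInv_fourier_eq]

/-- An identity between two distributions tested against the product of a real cut-off function
and a complex Schwartz function. -/
lemma add_eq_zero_of_test {Ω : Opens (EuclideanSpace ℝ (Fin n))}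
    {v : 𝓢'(EuclideanSpace ℝ (Fin n), ℂ)} {w : 𝓓'(Ω, ℂ)} {f : EuclideanSpace ℝ (Fin n) → ℂ}
    (hw : IsGivenByOn w f) (h : ∀ φ : 𝓓(Ω, ℝ), v (testToSchwartz φ) + w φ = 0) (ψ : 𝓓(Ω, ℝ))
    (φ : 𝓢(EuclideanSpace ℝ (Fin n), ℂ)) :
    v (schwartzMul φ (testToSchwartz ψ)) + ∫ x, φ x * (ψ x * f x) = 0 := by
  -- Test functions on `Ω` are real, so the complex product is tested through its real and imaginary
  -- parts.
  let re : 𝓓(Ω, ℝ) := ⟨fun x => (φ x).re * ψ x,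
    (Complex.reCLM.contDiff.comp (φ.smooth ⊤)).mul ψ.contDiff, ψ.hasCompactSupport.mul_left,
    (closure_mono (Function.support_mul_subset_right _ _)).trans ψ.tsupport_subset⟩
  let im : 𝓓(Ω, ℝ) := ⟨fun x => (φ x).im * ψ x,
    (Complex.imCLM.contDiff.comp (φ.smooth ⊤)).mul ψ.contDiff, ψ.hasCompactSupport.mul_left,
    (closure_mono (Function.support_mul_subset_right _ _)).trans ψ.tsupport_subset⟩
  have hre : ∀ x, (re x : ℂ) = (φ x).re * ψ x := fun x => Complex.ofReal_mul _ _
  have him : ∀ x, (im x : ℂ) = (φ x).im * ψ x := fun x => Complex.ofReal_mul _ _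
  have e : schwartzMul φ (testToSchwartz ψ) =
      testToSchwartz re + Complex.I • testToSchwartz im := by
    ext x
    rw [schwartzMul_apply, add_apply, smul_apply, testToSchwartz_apply,
      testToSchwartz_apply, testToSchwartz_apply, hre, him, smul_eq_mul]
    linear_combination (-(ψ x : ℂ)) * Complex.re_add_im (φ x)
  have i1 : Integrable fun x => (re x : ℂ) * f x := by
    simpa [Complex.real_smul] using re.integrable_bilin (ContinuousLinearMap.lsmul ℝ ℝ) hw.1
  have i2 : Integrable fun x => (im x : ℂ) * f x := by
    simpa [Complex.real_smul] using im.integrable_bilin (ContinuousLinearMap.lsmul ℝ ℝ) hw.1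
  have e2 : ∫ x, φ x * (ψ x * f x) = w re + Complex.I * w im := by
    rw [hw.2, hw.2, ← integral_const_mul, ← integral_add i1 (i2.const_mul _)]
    congr 1; ext x
    rw [hre, him]
    linear_combination (-((ψ x : ℂ) * f x)) * Complex.re_add_im (φ x)
  rw [e, e2, map_add, map_smul, smul_eq_mul]
  linear_combination h re + Complex.I * h im

end Distributions

/-! ### From solutions on the ball to the model equation -/

section Solutions

variable {n : ℕ}

/-- A smooth function supported in the unit ball and equal to `1` on the ball of radius `1/2`. -/
lemma exists_cutoff (n : ℕ) :
    ∃ ψ : 𝓓(openBall n 1, ℝ), ∀ x ∈ openBall n (1 / 2), ψ x = 1 := by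
  let b : ContDiffBump (0 : EuclideanSpace ℝ (Fin n)) :=
    ⟨1 / 2, 3 / 4, by norm_num, by norm_num⟩
  refine ⟨⟨b, b.contDiff, b.hasCompactSupport, ?_⟩, fun x hx => ?_⟩
  · rw [b.tsupport_eq]
    exact Metric.closedBall_subset_ball (by norm_num [b])
  · exact b.one_of_mem_closedBall (Metric.ball_subset_closedBall hx)

lemma integrableOn_potential_mul_besselInv (hn : 0 < n) {s c : ℝ} (hs : 0 < s) (hc : 0 < c)
    (hsn : 2 * s < n) (hcs : 2 * (c - s) ≤ n) {V : EuclideanSpace ℝ (Fin n) → ℂ}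
    (hV : MemLp V (ENNReal.ofReal ((n : ℝ) / c))
      (volume.restrict (openBall n 1 : Set (EuclideanSpace ℝ (Fin n)))))
    (G : Lp ℂ 2 (volume : Measure (EuclideanSpace ℝ (Fin n)))) :
    IntegrableOn (fun x => V x * besselInv s G x)
      (openBall n 1 : Set (EuclideanSpace ℝ (Fin n))) := by
  have : IsFiniteMeasure (volume.restrict
      (openBall n 1 : Set (EuclideanSpace ℝ (Fin n)))) :=
    ⟨by rw [Measure.restrict_apply_univ]; exact measure_ball_lt_top⟩
  have hf := memLp_besselInv (E := EuclideanSpace ℝ (Fin n)) hs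
    (by rw [finrank_euclideanSpace_fin]; exact hsn) G
  rw [finrank_euclideanSpace_fin] at hf
  exact integrable_of_potential (Nat.cast_pos.mpr hn) hc hsn hcs hV (hf.restrict _)

/-- The equation satisfied by a solution, tested against the product of a Fourier transform
and a cut-off function. -/
lemma integral_add_integral_eq_zero_of_solution {α s : ℝ}
    {Ω : Opens (EuclideanSpace ℝ (Fin n))} {V : EuclideanSpace ℝ (Fin n) → ℂ}
    {u w : 𝓓'(Ω, ℂ)} {v : 𝓢'(EuclideanSpace ℝ (Fin n), ℂ)}
    {G : Lp ℂ 2 (volume : Measure (EuclideanSpace ℝ (Fin n)))} (hs : 0 ≤ s)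
    (hu : IsExtension (besselInv s G : 𝓢'(EuclideanSpace ℝ (Fin n), ℂ)) u)
    (hv : IsFracLaplacian α (besselInv s G : 𝓢'(EuclideanSpace ℝ (Fin n), ℂ)) v)
    (hw : IsProduct V u w) (h : ∀ φ : 𝓓(Ω, ℝ), v (testToSchwartz φ) + w φ = 0)
    (ψ : 𝓓(Ω, ℝ)) (Y : 𝓢(EuclideanSpace ℝ (Fin n), ℂ)) :
    (∫ η, 𝓕⁻ (schwartzMul (𝓕 Y) (testToSchwartz ψ)) η *
        ((‖η‖ ^ (2 * α) * jap (-s) η : ℝ) * G η)) +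
      ∫ x, 𝓕 Y x * ((Ω : Set (EuclideanSpace ℝ (Fin n))).indicator
        (fun x => (((2 * Real.pi) ^ (2 * α))⁻¹ : ℝ) * V x) x *
          (testToSchwartz ψ x * besselInv s G x)) = 0 := by
  obtain ⟨g, hg, hgv⟩ := hv
  obtain ⟨f, hf, hfw⟩ := hw
  have hgG := hg.ae_eq (isGivenBy_fourier_besselInv s G)
  have hfG := hf.ae_eq hu.isGivenByOn
  have hpi : ((2 * Real.pi) ^ (2 * α) : ℝ) ≠ 0 := (by positivity : (0 : ℝ) < _).ne'
  have key := add_eq_zero_of_test hfw h ψ (𝓕 Y)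
  -- The factor `(2π)^{2α}` of the symbol is pulled out here and compensated by its inverse in the
  -- potential.
  have e1 : v (schwartzMul (𝓕 Y) (testToSchwartz ψ)) =
      (((2 * Real.pi) ^ (2 * α) : ℝ) : ℂ) *
        ∫ η, 𝓕⁻ (schwartzMul (𝓕 Y) (testToSchwartz ψ)) η *
        ((‖η‖ ^ (2 * α) * jap (-s) η : ℝ) * G η) := by
    have e := (hgv (𝓕⁻ (schwartzMul (𝓕 Y) (testToSchwartz ψ)))).2
    rw [TemperedDistribution.fourier_apply, FourierTransform.fourier_fourierInv_eq] at e
    rw [e, ← integral_const_mul]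
    apply integral_congr_ae
    filter_upwards [hgG, coeFn_besselMul hs G] with η h1 h2
    rw [h1, h2, Real.mul_rpow (by positivity) (norm_nonneg η)]
    push_cast
    ring
  have e2 : ∫ x, 𝓕 Y x * (ψ x * (V x * f x)) = (((2 * Real.pi) ^ (2 * α) : ℝ) : ℂ) *
      ∫ x, 𝓕 Y x * ((Ω : Set (EuclideanSpace ℝ (Fin n))).indicator
        (fun x => (((2 * Real.pi) ^ (2 * α))⁻¹ : ℝ) * V x) x *
          (testToSchwartz ψ x * besselInv s G x)) := by
    rw [← integral_const_mul]
    apply integral_congr_ae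
    filter_upwards [hfG] with x h1
    rw [testToSchwartz_apply]
    by_cases hx : x ∈ Ω
    · rw [h1 hx, Set.indicator_of_mem (SetLike.mem_coe.mpr hx)]
      have : (((2 * Real.pi) ^ (2 * α) : ℝ) : ℂ) * (((2 * Real.pi) ^ (2 * α))⁻¹ : ℝ) = 1 := by
        rw [← Complex.ofReal_mul, mul_inv_cancel₀ hpi, Complex.ofReal_one]
      linear_combination (-(𝓕 Y x * ψ x * V x * besselInv s G x)) * this
    · have : ψ x = 0 := image_eq_zero_of_notMem_tsupport fun hx' => hx (ψ.tsupport_subset hx')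
      simp [this]
  rw [e1, e2, ← mul_add] at key
  exact (mul_eq_zero.mp key).resolve_left (Complex.ofReal_ne_zero.mpr hpi)

/-- If a cut-off of `f` by a function equal to `1` on `Ω'` is in `H^t`, then so is the restriction
to `Ω'` of the distribution given by `f`. -/
lemma memSobolevOn_restrictTo {t : ℝ} (ht : 0 ≤ t) {Ω Ω' : Opens (EuclideanSpace ℝ (Fin n))}
    (hΩ : Ω' ≤ Ω) {u : 𝓓'(Ω, ℂ)} {f : EuclideanSpace ℝ (Fin n) → ℂ} (hu : IsGivenByOn u f)
    {ψ : 𝓓(Ω, ℝ)} (hψ : ∀ x ∈ Ω', ψ x = 1)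
    {G : Lp ℂ 2 (volume : Measure (EuclideanSpace ℝ (Fin n)))}
    (hG : besselInv t G =ᵐ[volume] fun x => testToSchwartz ψ x * f x) :
    MemSobolevOn t (restrictTo hΩ u) := by
  refine ⟨_, memSobolev_besselInv ht G, fun φ => ?_⟩
  change u (TestFunction.monoCLM ℝ φ) = _
  rw [hu.2, Lp.toTemperedDistribution_apply]
  apply integral_congr_ae
  filter_upwards [hG] with x hx
  rw [hx, TestFunction.monoCLM_apply, if_pos ⟨le_rfl, hΩ⟩, testToSchwartz_apply,
    testToSchwartz_apply, smul_eq_mul]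
  by_cases hx' : x ∈ Ω'
  · simp [hψ x hx']
  · have : φ x = 0 := image_eq_zero_of_notMem_tsupport fun h => hx' (φ.tsupport_subset h)
    simp [this]

end Solutions

theorem theorem1 (n : ℕ) (hn : 2 ≤ n) (α s : ℝ)
    (hα : 0 < 2 * α) (hαn : 2 * α < n) (hs : 0 < 2 * s) (hsn : 2 * s < n)
    (hs₁ : 2 * α - (n : ℝ) / 2 < s) (hs₂ : s < 2 * α) :
    ∃ ε : ℝ, 0 < ε ∧
      ∀ V : EuclideanSpace ℝ (Fin n) → ℂ,
        MemLp V (ENNReal.ofReal ((n : ℝ) / (2 * α)))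
          (volume.restrict (openBall n 1 : Set (EuclideanSpace ℝ (Fin n)))) →
        ∀ u : 𝓓'(openBall n 1, ℂ), MemSobolevOn s u →
          (∃ w : 𝓓'(openBall n 1, ℂ), IsProduct V u w) ∧
          (IsSolution α s V u →
            MemSobolevOn (s + ε)
              (restrictTo (Ω' := openBall n (1 / 2))
                (Metric.ball_subset_ball (by norm_num)) u)) := by
  have hs0 : 0 < s := by linarith
  -- The bound `1` is the commutator gain; half the gaps to `n / 2` and `2 * α` keep both
  -- embeddings, of `H^{s+ε}` and `H^{2α-s-ε}`, subcritical in order and of positive order.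
  obtain ⟨ε, hε0, hε1, hε2, hε3⟩ : ∃ ε : ℝ, 0 < ε ∧ ε ≤ 1 ∧ s + ε < 2 * α ∧
      2 * (s + ε) < n := by
    have h1 := min_le_left 1 (min (((n : ℝ) / 2 - s) / 2) ((2 * α - s) / 2))
    have h2 := min_le_right 1 (min (((n : ℝ) / 2 - s) / 2) ((2 * α - s) / 2))
    have h3 := min_le_left (((n : ℝ) / 2 - s) / 2) ((2 * α - s) / 2)
    have h4 := min_le_right (((n : ℝ) / 2 - s) / 2) ((2 * α - s) / 2)
    refine ⟨min 1 (min (((n : ℝ) / 2 - s) / 2) ((2 * α - s) / 2)),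
      lt_min one_pos (lt_min ?_ ?_), h1, ?_, ?_⟩ <;> linarith
  refine ⟨ε, hε0, fun V hV u ⟨u₀, hu₀, hu₀u⟩ => ⟨?_, ?_⟩⟩
  · obtain ⟨G, rfl⟩ := exists_eq_besselInv hs0.le hu₀
    obtain ⟨w, hw⟩ := exists_isGivenByOn
      (integrableOn_potential_mul_besselInv (by lia) hs0 hα hsn (by linarith) hV
        G).locallyIntegrableOn
    exact ⟨w, _, hu₀u.isGivenByOn, hw⟩
  -- The operator is nonlocal, so the extension `u₁` carrying the equation must be used; it may
  -- differ from `u₀` outside the ball.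
  · rintro ⟨u₁, v, w, hu₁, hu₁u, hv, hw, h⟩
    obtain ⟨G, rfl⟩ := exists_eq_besselInv hs0.le hu₁
    obtain ⟨ψ, hψ⟩ := exists_cutoff n
    have hU : MemLp ((openBall n 1 : Set (EuclideanSpace ℝ (Fin n))).indicator
        (fun x => ((((2 * Real.pi) ^ (2 * α))⁻¹ : ℝ) : ℂ) * V x))
        (ENNReal.ofReal (Module.finrank ℝ (EuclideanSpace ℝ (Fin n)) / (2 * α))) volume := by
      rw [finrank_euclideanSpace_fin,
        memLp_indicator_iff_restrict (openBall n 1).isOpen.measurableSet]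
      exact hV.const_mul _
    obtain ⟨G', hG'⟩ := exists_besselInv_eq_of_solution hs0 hε0 hε1 hε2
      (by rwa [finrank_euclideanSpace_fin])
      (by rw [finrank_euclideanSpace_fin]; linarith) hU (testToSchwartz ψ) G
      (integral_add_integral_eq_zero_of_solution hs0.le hu₁u hv hw h ψ)
    exact memSobolevOn_restrictTo (by linarith) _ hu₁u.isGivenByOn hψ hG'
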